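/- Notation. A connected, simply connected Lie group $G$ is called almost abelian if its Lie algebra $\mathfrak g$ has an abelian ideal of codimension one, and (non-)nilpotent if $\mathfrak g$ is (non-)nilpotent. A left-invariant Hermitian structure $(J,g)$ on $G$ is a complex structure $J$ on $\mathfrak g$ ($J^2=-\mathrm{Id}$, vanishing Nijenhuis tensor) together with an inner product $g$ satisfying $g(J\cdot,J\cdot)=g$; put $\omega=g(J\cdot,\cdot)$ and $d^c=i(\bar\partial-\partial)$. The structure is Kähler if $d\omega=0$ and SKT (pluriclosed) if $dd^c\omega=0$. A Lie algebra is unimodular if $\operatorname{tr}\operatorname{ad}_x=0$ for all $x$. A tuple such as $(f^{16},\dots,0)$ denotes the real Lie algebra having a basis with dual basis $f^1,\dots,f^6$ whose differentials $(df^1,\dots,df^6)$ are the entries, where $f^{ij}=f^i\wedge f^j$ and $df(x,y)=-f([x,y])$. Theorem. Let $G$ be a (connected, simply connected) non-nilpotent almost abelian Lie group of dimension six with Lie algebra $\mathfrak g$. (1) $G$ admits a left-invariant Kähler structure if and only if $\mathfrak g$ is isomorphic to one of the following: - $\mathfrak k_{11}^{p,0,0,s}=(pf^{16},f^{36},-f^{26},sf^{56},-sf^{46},0)$,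 $p\ne0$, $0<|s|\le1$; - $\mathfrak k_{13}=(f^{16},0,0,0,0,0)$; - $\mathfrak k_{15}^0=(f^{26},-f^{16},0,0,0,0)$; - $\mathfrak k_{19}^{p,0}=(pf^{16},f^{36},-f^{26},0,0,0)$, $p\neq 0$; - $\mathfrak k_{25}^{0,0,r}=(f^{26},-f^{16},rf^{46},-rf^{36},0,0)$, $0<|r|\le1$. Among these, exactly $\mathfrak k_{15}^0$ and $\mathfrak k_{25}^{0,0,r}$ (for all admissible $r$) are unimodular; $\mathfrak k_{11}^{p,0,0,s}$, $\mathfrak k_{13}$ and $\mathfrak k_{19}^{p,0}$ are unimodular for no admissible parameters. (2) $G$ admits a left-invariant SKT structure but no left-invariant Kähler structure if and only if $\mathfrak g$ is isomorphic to one of the following: - $\mathfrak k_1^{-\frac12,-\frac12}=(f^{16},-\frac12f^{26},-\frac12f^{36},-\frac12f^{46},-\frac12f^{56},0)$; - $\mathfrak k_8^{p,-\frac p2,0}=(pf^{16},-\frac p2f^{26},-\frac p2f^{36},f^{56},-f^{46},0)$, $p\ne0$; - $\mathfrak k_8^{p,-\frac p2,-\frac p2}=(pf^{16},-\frac p2f^{26},-\frac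 p2f^{36},-\frac p2f^{46}+f^{56},-f^{46}-\frac p2f^{56},0)$, $p\neq0$; - $\mathfrak k_{11}^{p,-\frac p2,0,s}=(pf^{16},-\frac p2f^{26}+f^{36},-f^{26}-\frac p2f^{36},sf^{56},-sf^{46},0)$, $p\ne0$, $s\neq0$; - $\mathfrak k_{11}^{p,-\frac p2,-\frac p2,s}=(pf^{16},-\frac p2f^{26}+f^{36},-f^{26}-\frac p2f^{36},-\frac p2f^{46}+sf^{56},-sf^{46}-\frac p2f^{56},0)$, $p\neq0$, $0<|s|\le1$; - $\mathfrak k_{17}^{-\frac12}=(f^{16},-\frac12f^{26},-\frac12f^{36},0,0,0)$; - $\mathfrak k_{19}^{p,-\frac p2}=(pf^{16},-\frac p2f^{26}+f^{36},-f^{26}-\frac p2f^{36},0,0,0)$, $p\ne0$; - $\mathfrak k_{23}^0=(f^{26},-f^{16},f^{46},0,0,0)$. Among these, exactly $\mathfrak k_8^{p,-\frac p2,0}$, $\mathfrak k_{11}^{p,-\frac p2,0,s}$, $\mathfrak k_{17}^{-\frac12}$, $\mathfrak k_{19}^{p,-\frac p2}$ and $\mathfrak k_{23}^0$ (for all admissible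 parameters) are unimodular; $\mathfrak k_1^{-\frac12,-\frac12}$, $\mathfrak k_8^{p,-\frac p2,-\frac p2}$ and $\mathfrak k_{11}^{p,-\frac p2,-\frac p2,s}$ are unimodular for no admissible parameters. -/

import Mathlib

open scoped Manifold ContDiff

namespace AlmostAbelianSKT

section LieAlgebra

variable (L : Type*) [LieRing L] [LieAlgebra ℝ L]

/-- A real Lie algebra is *almost abelian* if it has an abelian ideal of codimension one. -/
def IsAlmostAbelian : Prop :=
  ∃ I : LieIdeal ℝ L, IsLieAbelian I ∧ Module.finrank ℝ (L ⧸ I.toSubmodule) = 1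

/-- A real (finite-dimensional) Lie algebra is *unimodular* if every `ad x` is trace-free. -/
def IsUnimodular : Prop :=
  ∀ x : L, LinearMap.trace ℝ L (LieAlgebra.ad ℝ L x) = 0

/-- Two real Lie algebras are isomorphic. -/
def IsIsomorphic (L' : Type*) [LieRing L'] [LieAlgebra ℝ L'] : Prop :=
  Nonempty (L ≃ₗ⁅ℝ⁆ L')

/-- A *Hermitian structure* on a real Lie algebra: a complex structure `J` (an almost complex
structure with vanishing Nijenhuis tensor) together with a compatible inner product.  On the Lie
algebra of a Lie group this is the same thing as a left-invariant Hermitian structure on the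
group. -/
structure HermitianStructure where
  /-- the complex structure -/
  J : L →ₗ[ℝ] L
  J_J : ∀ x, J (J x) = -x
  integrable : ∀ x y, ⁅J x, J y⁆ - J ⁅J x, y⁆ - J ⁅x, J y⁆ - ⁅x, y⁆ = 0
  /-- the metric -/
  metric : LinearMap.BilinForm ℝ L
  metric_symm : ∀ x y, metric x y = metric y x
  metric_pos : ∀ x, x ≠ 0 → 0 < metric x x
  metric_J : ∀ x y, metric (J x) (J y) = metric x y

variable {L}

/-- The Chevalley–Eilenberg differential of a 2-form on a Lie algebra (with trivial coefficients),
i.e. the exterior derivative of the corresponding left-invariant form: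
`dα(x₀,x₁,x₂) = ∑_{i<j} (-1)^{i+j} α([x_i,x_j],…)`. -/
def d₂ (α : L → L → ℝ) (x₀ x₁ x₂ : L) : ℝ :=
  -α ⁅x₀, x₁⁆ x₂ + α ⁅x₀, x₂⁆ x₁ - α ⁅x₁, x₂⁆ x₀

/-- The Chevalley–Eilenberg differential of a 3-form on a Lie algebra:
`dη(x₀,x₁,x₂,x₃) = ∑_{i<j} (-1)^{i+j} η([x_i,x_j],…)`. -/
def d₃ (η : L → L → L → ℝ) (x₀ x₁ x₂ x₃ : L) : ℝ :=
  -η ⁅x₀, x₁⁆ x₂ x₃ + η ⁅x₀, x₂⁆ x₁ x₃ - η ⁅x₀, x₃⁆ x₁ x₂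
    - η ⁅x₁, x₂⁆ x₀ x₃ + η ⁅x₁, x₃⁆ x₀ x₂ - η ⁅x₂, x₃⁆ x₀ x₁

namespace HermitianStructure

variable (S : HermitianStructure L)

/-- The fundamental form `ω(x, y) = g(J x, y)`. -/
def fundamentalForm (x y : L) : ℝ := S.metric (S.J x) y

/-- `d^c ω = i(∂̄ - ∂)ω`, that is `d^c ω(x, y, z) = -dω(J x, J y, J z)`. -/
def dcFundamentalForm (x y z : L) : ℝ := -d₂ S.fundamentalForm (S.J x) (S.J y) (S.J z)

/-- The structure is *Kähler*: `dω = 0`. -/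
def IsKahler : Prop := ∀ x y z, d₂ S.fundamentalForm x y z = 0

/-- The structure is *SKT* (strong Kähler with torsion, or pluriclosed): `d d^c ω = 0`. -/
def IsSKT : Prop := ∀ x y z w, d₃ S.dcFundamentalForm x y z w = 0

end HermitianStructure

variable (L)

/-- `L` carries a Kähler structure. -/
def AdmitsKahler : Prop := ∃ S : HermitianStructure L, S.IsKahler

/-- `L` carries an SKT structure. -/
def AdmitsSKT : Prop := ∃ S : HermitianStructure L, S.IsSKT

end LieAlgebra

/-- The six-dimensional Lie algebra with a basis `e₁, …, e₆` whose dual basis `f¹, …, f⁶` satisfies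
`df^i = ∑_j B_{ij} f^j ∧ f⁶` for `i = 1, …, 5` and `df⁶ = 0`.  Equivalently (by
`df(x, y) = -f([x, y])`), `e₁, …, e₅` commute and `[e₆, e_j] = ∑_i B_{ij} e_i`.
The first component of a pair collects the coordinates along `e₁, …, e₅`, the second one is the
coordinate along `e₆`.  Row `i` of `B` lists the coefficients of `df^i`. -/
def AlmostAbelianAlgebra (_B : Matrix (Fin 5) (Fin 5) ℝ) : Type := (Fin 5 → ℝ) × ℝ

namespace AlmostAbelianAlgebra

variable (B : Matrix (Fin 5) (Fin 5) ℝ)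

instance : AddCommGroup (AlmostAbelianAlgebra B) := inferInstanceAs (AddCommGroup ((Fin 5 → ℝ) × ℝ))

instance : Module ℝ (AlmostAbelianAlgebra B) := inferInstanceAs (Module ℝ ((Fin 5 → ℝ) × ℝ))

open Matrix in
instance : Bracket (AlmostAbelianAlgebra B) (AlmostAbelianAlgebra B) where
  bracket x y := ((x.2 • (B *ᵥ y.1) - y.2 • (B *ᵥ x.1), 0) : (Fin 5 → ℝ) × ℝ)

open Matrix in
theorem fst_lie (x y : AlmostAbelianAlgebra B) :
    (⁅x, y⁆).1 = x.2 • (B *ᵥ y.1) - y.2 • (B *ᵥ x.1) := rfl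

theorem snd_lie (x y : AlmostAbelianAlgebra B) : (⁅x, y⁆).2 = 0 := rfl

theorem fst_add (x y : AlmostAbelianAlgebra B) : (x + y).1 = x.1 + y.1 := rfl

theorem snd_add (x y : AlmostAbelianAlgebra B) : (x + y).2 = x.2 + y.2 := rfl

theorem fst_smul (c : ℝ) (x : AlmostAbelianAlgebra B) : (c • x).1 = c • x.1 := rfl

theorem snd_smul (c : ℝ) (x : AlmostAbelianAlgebra B) : (c • x).2 = c * x.2 := rfl

instance : LieRing (AlmostAbelianAlgebra B) where
  add_lie x y z := by
    refine Prod.ext ?_ ?_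
    · simp only [fst_lie, fst_add, snd_add, Matrix.mulVec_add]
      module
    · simp only [snd_lie, snd_add, add_zero]
  lie_add x y z := by
    refine Prod.ext ?_ ?_
    · simp only [fst_lie, fst_add, snd_add, Matrix.mulVec_add]
      module
    · simp only [snd_lie, snd_add, add_zero]
  lie_self x := by
    refine Prod.ext ?_ rfl
    rw [fst_lie, sub_self]
    rfl
  leibniz_lie x y z := by
    refine Prod.ext ?_ ?_
    · simp only [fst_lie, fst_add, snd_lie, Matrix.mulVec_sub, Matrix.mulVec_smul]
      module
    · simp only [snd_lie, snd_add, add_zero]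

instance : LieAlgebra ℝ (AlmostAbelianAlgebra B) where
  lie_smul c x y := by
    refine Prod.ext ?_ ?_
    · simp only [fst_lie, fst_smul, snd_smul, Matrix.mulVec_smul]
      module
    · simp only [snd_lie, snd_smul, mul_zero]

end AlmostAbelianAlgebra

/-- `(f¹⁶, p f²⁶, p f³⁶, r f⁴⁶, r f⁵⁶, 0)` -/
abbrev K1 (p r : ℝ) : Type := AlmostAbelianAlgebra
  !![1, 0, 0, 0, 0;
     0, p, 0, 0, 0;
     0, 0, p, 0, 0;
     0, 0, 0, r, 0;
     0, 0, 0, 0, r]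

/-- `(p f¹⁶, q f²⁶, q f³⁶, s f⁴⁶ + f⁵⁶, -f⁴⁶ + s f⁵⁶, 0)` -/
abbrev K8 (p q s : ℝ) : Type := AlmostAbelianAlgebra
  !![p, 0, 0, 0, 0;
     0, q, 0, 0, 0;
     0, 0, q, 0, 0;
     0, 0, 0, s, 1;
     0, 0, 0, -1, s]

/-- `(p f¹⁶, q f²⁶ + f³⁶, -f²⁶ + q f³⁶, r f⁴⁶ + s f⁵⁶, -s f⁴⁶ + r f⁵⁶, 0)` -/
abbrev K11 (p q r s : ℝ) : Type := AlmostAbelianAlgebra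
  !![p, 0, 0, 0, 0;
     0, q, 1, 0, 0;
     0, -1, q, 0, 0;
     0, 0, 0, r, s;
     0, 0, 0, -s, r]

/-- `(f¹⁶, 0, 0, 0, 0, 0)` -/
abbrev K13 : Type := AlmostAbelianAlgebra
  !![1, 0, 0, 0, 0;
     0, 0, 0, 0, 0;
     0, 0, 0, 0, 0;
     0, 0, 0, 0, 0;
     0, 0, 0, 0, 0]

/-- `(p f¹⁶ + f²⁶, -f¹⁶ + p f²⁶, 0, 0, 0, 0)` -/
abbrev K15 (p : ℝ) : Type := AlmostAbelianAlgebra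
  !![p, 1, 0, 0, 0;
     -1, p, 0, 0, 0;
     0, 0, 0, 0, 0;
     0, 0, 0, 0, 0;
     0, 0, 0, 0, 0]

/-- `(f¹⁶, p f²⁶, p f³⁶, 0, 0, 0)` -/
abbrev K17 (p : ℝ) : Type := AlmostAbelianAlgebra
  !![1, 0, 0, 0, 0;
     0, p, 0, 0, 0;
     0, 0, p, 0, 0;
     0, 0, 0, 0, 0;
     0, 0, 0, 0, 0]

/-- `(p f¹⁶, q f²⁶ + f³⁶, -f²⁶ + q f³⁶, 0, 0, 0)` -/
abbrev K19 (p q : ℝ) : Type := AlmostAbelianAlgebra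
  !![p, 0, 0, 0, 0;
     0, q, 1, 0, 0;
     0, -1, q, 0, 0;
     0, 0, 0, 0, 0;
     0, 0, 0, 0, 0]

/-- `(p f¹⁶ + f²⁶, -f¹⁶ + p f²⁶, f⁴⁶, 0, 0, 0)` -/
abbrev K23 (p : ℝ) : Type := AlmostAbelianAlgebra
  !![p, 1, 0, 0, 0;
     -1, p, 0, 0, 0;
     0, 0, 0, 1, 0;
     0, 0, 0, 0, 0;
     0, 0, 0, 0, 0]

/-- `(p f¹⁶ + f²⁶, -f¹⁶ + p f²⁶, q f³⁶ + r f⁴⁶, -r f³⁶ + q f⁴⁶, 0, 0)` -/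
abbrev K25 (p q r : ℝ) : Type := AlmostAbelianAlgebra
  !![p, 1, 0, 0, 0;
     -1, p, 0, 0, 0;
     0, 0, q, r, 0;
     0, 0, -r, q, 0;
     0, 0, 0, 0, 0]

section LieGroup

variable (G : Type*) [TopologicalSpace G] [ChartedSpace (EuclideanSpace ℝ (Fin 6)) G] [Group G]
  [LieGroup (𝓡 6) ∞ G]

/-- A smooth real Lie group has the finite smoothness that Mathlib asks for in order to define its
Lie algebra. -/
instance : LieGroup (𝓡 6) (minSmoothness ℝ 3) G := by
  rw [minSmoothness_of_isRCLikeNormedField]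
  infer_instance

/-- The Lie algebra of a six-dimensional Lie group: the tangent space at the identity with the
bracket of left-invariant vector fields. -/
abbrev LieAlg : Type := GroupLieAlgebra (𝓡 6) G

/-- A Lie group is almost abelian if its Lie algebra is. -/
def IsAlmostAbelianGroup : Prop := IsAlmostAbelian (LieAlg G)

/-- A (connected) Lie group is nilpotent if its Lie algebra is. -/
def IsNilpotentGroup : Prop := LieRing.IsNilpotent (LieAlg G)

/-- `G` admits a left-invariant Kähler structure.  A left-invariant Hermitian structure on `G` is
given by its value at the identity, and the Nijenhuis tensor and the exterior derivatives of
left-invariant tensors, evaluated on left-invariant vector fields, are the algebraic expressions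
used in the definitions for Lie algebras. -/
def AdmitsLeftInvariantKahler : Prop := AdmitsKahler (LieAlg G)

/-- `G` admits a left-invariant SKT structure. -/
def AdmitsLeftInvariantSKT : Prop := AdmitsSKT (LieAlg G)

end LieGroup

end AlmostAbelianSKT

/-!
The statement concerns only the Lie algebra `L` of the group, a six-dimensional real Lie algebra
with an abelian ideal `I` of codimension one.

Let `(J, g)` be a Hermitian structure on `L` and `e` a unit normal of `I`.  Then `J e ∈ I`, and
integrability says that `ad e` preserves the maximal complex subspace `V = {e, J e}^⊥` of `I` and is
complex linear there.  As `V` has complex dimension two, a complex eigenvector of `ad e` gives a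
unitary frame of `V` in which `ad e` is triangular (`exists_isAdaptedFrame`).  The SKT condition,
evaluated on this frame, is a system of four equations; a sum-of-squares argument shows that the
off-diagonal entry vanishes and that the eigenvalues of `ad e` on `V` have real part `0` or `-a / 2`,
where `a` is the `J e`-component of `[e, J e]` (`IsAdaptedFrame.skt`).  For a Kähler structure
`ad e` is moreover block diagonal, and skew-symmetric on `V` (`IsAdaptedFrame.kahler`).  So `L` is
isomorphic to the algebra of an explicit `5 × 5` matrix `normalForm`.  Conversely the standard
Hermitian structure of such an algebra is SKT, respectively Kähler.

An almost abelian algebra depends on its matrix only up to conjugation and scaling, so the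
classification is a case distinction on the parameters of `normalForm`.  The component `v` of
`[e, J e]` in `V` can be removed except where `a = 0` and `ad e` has a kernel on `V`; this is the
origin of `𝔨₂₃⁰`.

That an algebra of the second list has no Kähler structure follows from two properties of the Kähler
normal forms that are invariant under isomorphism: no `ad E` has an eigenvalue with non-zero real
part on a plane (`not_linearIndependent_of_kahler_normalForm`), and a non-nilpotent `ad E` has no
nilpotent Jordan block (`lie_eq_zero_of_kahler_normalForm`).
-/

open scoped Manifold ContDiff

namespace AlmostAbelianSKT

/-! ### Isomorphisms and transport of structure -/

section Transport

variable {L L' L'' : Type*} [LieRing L] [LieAlgebra ℝ L] [LieRing L'] [LieAlgebra ℝ L']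
  [LieRing L''] [LieAlgebra ℝ L'']

theorem IsIsomorphic.symm (h : IsIsomorphic L L') : IsIsomorphic L' L :=
  h.map LieEquiv.symm

theorem IsIsomorphic.trans (h : IsIsomorphic L L') (h' : IsIsomorphic L' L'') :
    IsIsomorphic L L'' :=
  h.elim fun f => h'.elim fun g => ⟨f.trans g⟩

/-- The pull-back of a Hermitian structure along an isomorphism of Lie algebras. -/
def HermitianStructure.comap (S : HermitianStructure L') (f : L ≃ₗ⁅ℝ⁆ L') :
    HermitianStructure L where
  J := f.symm.toLinearEquiv.toLinearMap ∘ₗ S.J ∘ₗ f.toLinearEquiv.toLinearMap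
  J_J x := by simp [S.J_J]
  integrable x y := by
    apply f.injective
    simpa [LieEquiv.map_lie] using S.integrable (f x) (f y)
  metric := S.metric.compl₁₂ f.toLinearEquiv.toLinearMap f.toLinearEquiv.toLinearMap
  metric_symm x y := S.metric_symm _ _
  metric_pos x hx := S.metric_pos _ (by simpa using hx)
  metric_J x y := by simpa using S.metric_J (f x) (f y)

theorem IsIsomorphic.admitsKahler (h : IsIsomorphic L L') (hK : AdmitsKahler L') :
    AdmitsKahler L := by
  obtain ⟨f⟩ := h
  obtain ⟨S, hS⟩ := hK
  refine ⟨S.comap f, fun x y z => ?_⟩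
  simpa [d₂, HermitianStructure.fundamentalForm, HermitianStructure.comap, LieEquiv.map_lie]
    using hS (f x) (f y) (f z)

theorem IsIsomorphic.admitsSKT (h : IsIsomorphic L L') (hK : AdmitsSKT L') :
    AdmitsSKT L := by
  obtain ⟨f⟩ := h
  obtain ⟨S, hS⟩ := hK
  refine ⟨S.comap f, fun x y z w => ?_⟩
  simpa [d₃, d₂, HermitianStructure.dcFundamentalForm, HermitianStructure.fundamentalForm,
    HermitianStructure.comap, LieEquiv.map_lie] using hS (f x) (f y) (f z) (f w)

theorem HermitianStructure.IsKahler.isSKT {S : HermitianStructure L} (h : S.IsKahler) :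
    S.IsSKT := fun x y z w => by
  simp [d₃, dcFundamentalForm, h _ _ _]

end Transport

namespace AlmostAbelianAlgebra

open Matrix

variable {B B' : Matrix (Fin 5) (Fin 5) ℝ}

@[ext]
theorem ext {x y : AlmostAbelianAlgebra B} (h₁ : x.1 = y.1) (h₂ : x.2 = y.2) : x = y :=
  Prod.ext h₁ h₂

theorem fst_zero : (0 : AlmostAbelianAlgebra B).1 = 0 := rfl

theorem snd_zero : (0 : AlmostAbelianAlgebra B).2 = 0 := rfl

theorem fst_sub (x y : AlmostAbelianAlgebra B) : (x - y).1 = x.1 - y.1 := rfl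

theorem snd_sub (x y : AlmostAbelianAlgebra B) : (x - y).2 = x.2 - y.2 := rfl

theorem fst_neg (x : AlmostAbelianAlgebra B) : (-x).1 = -x.1 := rfl

theorem snd_neg (x : AlmostAbelianAlgebra B) : (-x).2 = -x.2 := rfl

variable (B) in
/-- The identification of the underlying vector space with `ℝ⁵ × ℝ`. -/
def equivProd : AlmostAbelianAlgebra B ≃ₗ[ℝ] (Fin 5 → ℝ) × ℝ where
  toFun x := x
  invFun x := x
  map_add' _ _ := rfl
  map_smul' _ _ := rfl

instance : Module.Finite ℝ (AlmostAbelianAlgebra B) := Module.Finite.equiv (equivProd B).symm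

theorem finrank_eq : Module.finrank ℝ (AlmostAbelianAlgebra B) = 6 := by
  rw [(equivProd B).finrank_eq]
  simp

/-- The element with coordinates `x` along `e₁, …, e₅` and `t` along `e₆`. -/
def mk (x : Fin 5 → ℝ) (t : ℝ) : AlmostAbelianAlgebra B := (x, t)

@[simp]
theorem fst_mk (x : Fin 5 → ℝ) (t : ℝ) : (mk x t : AlmostAbelianAlgebra B).1 = x := rfl

@[simp]
theorem snd_mk (x : Fin 5 → ℝ) (t : ℝ) : (mk x t : AlmostAbelianAlgebra B).2 = t := rfl

/-- The algebra depends on `B` only up to conjugation and non-zero scaling. -/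
theorem isIsomorphic_of_conj (P Q : Matrix (Fin 5) (Fin 5) ℝ) (c : ℝ) (hc : c ≠ 0)
    (hPQ : P * Q = 1) (h : P * B = c • (B' * P)) :
    IsIsomorphic (AlmostAbelianAlgebra B) (AlmostAbelianAlgebra B') := by
  have hQP : Q * P = 1 := mul_eq_one_comm.mp hPQ
  have h' (y : Fin 5 → ℝ) : P *ᵥ (B *ᵥ y) = c • (B' *ᵥ (P *ᵥ y)) := by
    rw [mulVec_mulVec, h, smul_mulVec, mulVec_mulVec]
  exact ⟨{
    toFun := fun x => mk (P *ᵥ x.1) (c * x.2)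
    invFun := fun x => mk (Q *ᵥ x.1) (c⁻¹ * x.2)
    map_add' := fun x y => ext (by simp [fst_add, mulVec_add])
      (by simp [snd_add, mul_add])
    map_smul' := fun r x => ext (by simp [fst_smul, mulVec_smul])
      (by simp [snd_smul, mul_left_comm])
    map_lie' := fun {x y} => by
      refine ext ?_ ?_
      · simp only [fst_lie, fst_mk, snd_mk, mulVec_sub, mulVec_smul, h']
        module
      · simp only [snd_lie, snd_mk, mul_zero]
    left_inv := fun x => ext (by simp [hQP]) (by simp [hc])
    right_inv := fun x => ext (by simp [hPQ]) (by simp [hc]) }⟩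

/-- A Lie algebra of dimension six is recognised from a frame `f₁, …, f₅, e` with the bracket
relations of the standard basis. -/
theorem isIsomorphic_of_frame {L : Type*} [LieRing L] [LieAlgebra ℝ L]
    (hL : Module.finrank ℝ L = 6) (f : Fin 5 → L) (e : L)
    (hind : ∀ (x : Fin 5 → ℝ) (t : ℝ), ∑ i, x i • f i + t • e = 0 → x = 0 ∧ t = 0)
    (hff : ∀ i j, ⁅f i, f j⁆ = 0) (hef : ∀ j, ⁅e, f j⁆ = ∑ i, B i j • f i) :
    IsIsomorphic L (AlmostAbelianAlgebra B) := by
  have hfin : Module.Finite ℝ L := Module.finite_of_finrank_pos (by omega)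
  let F : AlmostAbelianAlgebra B →ₗ[ℝ] L :=
    { toFun := fun x => ∑ i, x.1 i • f i + x.2 • e
      map_add' := fun x y => by
        simp only [fst_add, snd_add, Pi.add_apply, add_smul, Finset.sum_add_distrib]
        abel
      map_smul' := fun r x => by
        simp only [fst_smul, snd_smul, Pi.smul_apply, smul_eq_mul, mul_smul, Finset.smul_sum,
          smul_add, RingHom.id_apply] }
  have hF (x : AlmostAbelianAlgebra B) : F x = ∑ i, x.1 i • f i + x.2 • e := rfl
  have hinj : Function.Injective F := by
    rw [← LinearMap.ker_eq_bot, LinearMap.ker_eq_bot']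
    intro x hx
    obtain ⟨h1, h2⟩ := hind x.1 x.2 hx
    exact ext h1 h2
  have heB (y : Fin 5 → ℝ) : ⁅e, ∑ i, y i • f i⁆ = ∑ i, (B *ᵥ y) i • f i := by
    simp only [lie_sum, lie_smul, hef, mulVec, dotProduct, Finset.smul_sum, Finset.sum_smul,
      smul_smul]
    rw [Finset.sum_comm]
    simp only [mul_comm]
  have hff' (x y : Fin 5 → ℝ) : ⁅∑ i, x i • f i, ∑ i, y i • f i⁆ = 0 := by
    simp [lie_sum, sum_lie, hff]
  have hbij : Function.Bijective F :=
    ⟨hinj, (LinearMap.injective_iff_surjective_of_finrank_eq_finrank (by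
      rw [hL, finrank_eq])).mp hinj⟩
  refine IsIsomorphic.symm ⟨LieEquiv.ofBijective { F with map_lie' := fun {x y} => ?_ } hbij⟩
  change F ⁅x, y⁆ = ⁅F x, F y⁆
  rw [hF, hF, hF, fst_lie, snd_lie, add_lie, lie_add, lie_add, hff', lie_smul, smul_lie, smul_lie,
    lie_smul, lie_self, ← lie_skew, heB, heB]
  simp only [Pi.sub_apply, Pi.smul_apply, sub_smul, Finset.sum_sub_distrib, smul_assoc,
    Finset.smul_sum]
  simp [Finset.smul_sum]
  abel

/-! ### Unimodularity -/

theorem trace_ad (x : AlmostAbelianAlgebra B) :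
    LinearMap.trace ℝ _ (LieAlgebra.ad ℝ (AlmostAbelianAlgebra B) x) = x.2 * B.trace := by
  let b := ((Pi.basisFun ℝ (Fin 5)).prod (Module.Basis.singleton Unit ℝ)).map (equivProd B).symm
  rw [LinearMap.trace_eq_matrix_trace ℝ b, Matrix.trace, Fintype.sum_sum_type]
  have h1 (i : Fin 5) : LinearMap.toMatrix b b (LieAlgebra.ad ℝ (AlmostAbelianAlgebra B) x)
      (Sum.inl i) (Sum.inl i) = x.2 * B i i := by
    have hb : b (Sum.inl i) = (equivProd B).symm (Pi.single i 1, 0) := by simp [b]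
    rw [LinearMap.toMatrix_apply, LieAlgebra.ad_apply, hb]
    change (x.2 • (B *ᵥ Pi.single i 1) - (0 : ℝ) • (B *ᵥ x.1)) i = _
    simp
  have h2 : LinearMap.toMatrix b b (LieAlgebra.ad ℝ (AlmostAbelianAlgebra B) x)
      (Sum.inr ()) (Sum.inr ()) = 0 := by
    have hb (z : AlmostAbelianAlgebra B) : b.repr z (Sum.inr ()) = z.2 := by simp [b]; rfl
    rw [LinearMap.toMatrix_apply, LieAlgebra.ad_apply, hb, snd_lie]
  simp only [Matrix.diag_apply, h1, Finset.univ_unique, Finset.sum_singleton]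
  rw [show (default : Unit) = () from rfl, h2, add_zero, Matrix.trace, Finset.mul_sum]
  rfl

theorem isUnimodular_iff : IsUnimodular (AlmostAbelianAlgebra B) ↔ B.trace = 0 := by
  refine ⟨fun h => ?_, fun h x => by rw [trace_ad, h, mul_zero]⟩
  have := h (mk 0 1)
  rw [trace_ad] at this
  simpa using this

end AlmostAbelianAlgebra

namespace AlmostAbelianAlgebra

open Matrix

/-! ### The normal form -/

/-- The matrix of `ad e₆` in a frame adapted to a Hermitian structure: `J e₆ = e₁`, `J e₂ = e₃`,
`J e₄ = e₅`.  The two diagonal `2 × 2` blocks are the complex numbers `c - αi` and `d - δi`, and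
`v = (v₁ + v₂i, v₃ + v₄i)` is the component of `[e₆, e₁]` in the maximal complex subspace of the
abelian ideal. -/
def normalForm (a v₁ v₂ v₃ v₄ c α d δ : ℝ) : Matrix (Fin 5) (Fin 5) ℝ :=
  !![a, 0, 0, 0, 0;
     v₁, c, α, 0, 0;
     v₂, -α, c, 0, 0;
     v₃, 0, 0, d, δ;
     v₄, 0, 0, -δ, d]

theorem normalForm_swap (a v₁ v₂ v₃ v₄ c α d δ : ℝ) :
    IsIsomorphic (AlmostAbelianAlgebra (normalForm a v₁ v₂ v₃ v₄ c α d δ))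
      (AlmostAbelianAlgebra (normalForm a v₃ v₄ v₁ v₂ d δ c α)) := by
  let P : Matrix (Fin 5) (Fin 5) ℝ :=
    !![1, 0, 0, 0, 0; 0, 0, 0, 1, 0; 0, 0, 0, 0, 1; 0, 1, 0, 0, 0; 0, 0, 1, 0, 0]
  refine isIsomorphic_of_conj P P 1 one_ne_zero ?_ ?_
  · ext i j; fin_cases i <;> fin_cases j <;> simp [P, Matrix.mul_apply, Fin.sum_univ_five]
  · ext i j; fin_cases i <;> fin_cases j <;>
      simp [P, normalForm, Matrix.mul_apply, Fin.sum_univ_five]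

theorem normalForm_scale (a v₁ v₂ v₃ v₄ c α d δ t : ℝ) (ht : t ≠ 0) :
    IsIsomorphic (AlmostAbelianAlgebra (normalForm a v₁ v₂ v₃ v₄ c α d δ))
      (AlmostAbelianAlgebra (normalForm (a / t) (v₁ / t) (v₂ / t) (v₃ / t) (v₄ / t) (c / t)
        (α / t) (d / t) (δ / t))) := by
  refine isIsomorphic_of_conj 1 1 t ht (mul_one _) ?_
  ext i j; fin_cases i <;> fin_cases j <;> simp [normalForm] <;> field_simp

/-- The component of `v` in the first block can be removed when `a` is not an eigenvalue of that
block. -/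
theorem normalForm_remove (a v₁ v₂ v₃ v₄ c α d δ : ℝ) (h : (c - a) ^ 2 + α ^ 2 ≠ 0) :
    IsIsomorphic (AlmostAbelianAlgebra (normalForm a v₁ v₂ v₃ v₄ c α d δ))
      (AlmostAbelianAlgebra (normalForm a 0 0 v₃ v₄ c α d δ)) := by
  -- `(w₁, w₂)` solves `(block - a) w = v`.
  obtain ⟨w₁, w₂, h₁, h₂⟩ : ∃ w₁ w₂ : ℝ, v₁ = (c - a) * w₁ + α * w₂ ∧
      v₂ = -α * w₁ + (c - a) * w₂ :=
    ⟨((c - a) * v₁ - α * v₂) / ((c - a) ^ 2 + α ^ 2),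
      (α * v₁ + (c - a) * v₂) / ((c - a) ^ 2 + α ^ 2), by field_simp; ring, by field_simp; ring⟩
  refine isIsomorphic_of_conj
    !![1, 0, 0, 0, 0; w₁, 1, 0, 0, 0; w₂, 0, 1, 0, 0; 0, 0, 0, 1, 0; 0, 0, 0, 0, 1]
    !![1, 0, 0, 0, 0; -w₁, 1, 0, 0, 0; -w₂, 0, 1, 0, 0; 0, 0, 0, 1, 0; 0, 0, 0, 0, 1]
    1 one_ne_zero ?_ ?_
  · ext i j; fin_cases i <;> fin_cases j <;> simp [Matrix.mul_apply, Fin.sum_univ_five]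
  · ext i j; fin_cases i <;> fin_cases j <;>
      simp [normalForm, Matrix.mul_apply, Fin.sum_univ_five, h₁, h₂] <;> ring

theorem normalForm_remove_both (a v₁ v₂ v₃ v₄ c α d δ : ℝ) (h : (c - a) ^ 2 + α ^ 2 ≠ 0)
    (h' : (d - a) ^ 2 + δ ^ 2 ≠ 0) :
    IsIsomorphic (AlmostAbelianAlgebra (normalForm a v₁ v₂ v₃ v₄ c α d δ))
      (AlmostAbelianAlgebra (normalForm a 0 0 0 0 c α d δ)) :=
  (normalForm_remove _ _ _ _ _ _ _ _ _ h).trans <| (normalForm_swap _ _ _ _ _ _ _ _ _).trans <|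
    (normalForm_remove _ _ _ _ _ _ _ _ _ h').trans (normalForm_swap _ _ _ _ _ _ _ _ _)

/-- When the second block vanishes and `a = 0`, a non-zero component `v₃ + v₄i` can be normalised to
`1` by a complex multiplication in the second block. -/
theorem normalForm_normalize (v₁ v₂ v₃ v₄ c α : ℝ) (h : v₃ ≠ 0 ∨ v₄ ≠ 0) :
    IsIsomorphic (AlmostAbelianAlgebra (normalForm 0 v₁ v₂ v₃ v₄ c α 0 0))
      (AlmostAbelianAlgebra (normalForm 0 v₁ v₂ 1 0 c α 0 0)) := by
  have hn : v₃ ^ 2 + v₄ ^ 2 ≠ 0 := by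
    rcases h with h | h <;> positivity
  refine isIsomorphic_of_conj
    !![1, 0, 0, 0, 0; 0, 1, 0, 0, 0; 0, 0, 1, 0, 0;
      0, 0, 0, v₃ / (v₃ ^ 2 + v₄ ^ 2), v₄ / (v₃ ^ 2 + v₄ ^ 2);
      0, 0, 0, -v₄ / (v₃ ^ 2 + v₄ ^ 2), v₃ / (v₃ ^ 2 + v₄ ^ 2)]
    !![1, 0, 0, 0, 0; 0, 1, 0, 0, 0; 0, 0, 1, 0, 0; 0, 0, 0, v₃, -v₄; 0, 0, 0, v₄, v₃]
    1 one_ne_zero ?_ ?_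
  · ext i j; fin_cases i <;> fin_cases j <;> simp [Matrix.mul_apply, Fin.sum_univ_five] <;>
      field_simp <;> ring
  · ext i j; fin_cases i <;> fin_cases j <;>
      simp [normalForm, Matrix.mul_apply, Fin.sum_univ_five] <;> field_simp <;> ring

/-! ### The algebras of the classification in normal form -/

theorem isIsomorphic_of_eq {B B' : Matrix (Fin 5) (Fin 5) ℝ} (h : B = B') :
    IsIsomorphic (AlmostAbelianAlgebra B) (AlmostAbelianAlgebra B') :=
  h ▸ ⟨LieEquiv.refl⟩

theorem K1_isIsomorphic (p r : ℝ) :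
    IsIsomorphic (K1 p r) (AlmostAbelianAlgebra (normalForm 1 0 0 0 0 p 0 r 0)) :=
  isIsomorphic_of_eq (by rw [normalForm, neg_zero])

theorem K8_isIsomorphic (p q s : ℝ) :
    IsIsomorphic (K8 p q s) (AlmostAbelianAlgebra (normalForm p 0 0 0 0 q 0 s 1)) :=
  isIsomorphic_of_eq (by rw [normalForm, neg_zero])

theorem K11_isIsomorphic (p q r s : ℝ) :
    IsIsomorphic (K11 p q r s) (AlmostAbelianAlgebra (normalForm p 0 0 0 0 q 1 r s)) :=
  ⟨LieEquiv.refl⟩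

theorem K13_isIsomorphic :
    IsIsomorphic K13 (AlmostAbelianAlgebra (normalForm 1 0 0 0 0 0 0 0 0)) :=
  isIsomorphic_of_eq (by rw [normalForm, neg_zero])

theorem K17_isIsomorphic (p : ℝ) :
    IsIsomorphic (K17 p) (AlmostAbelianAlgebra (normalForm 1 0 0 0 0 p 0 0 0)) :=
  isIsomorphic_of_eq (by rw [normalForm, neg_zero])

theorem K19_isIsomorphic (p q : ℝ) :
    IsIsomorphic (K19 p q) (AlmostAbelianAlgebra (normalForm p 0 0 0 0 q 1 0 0)) :=
  isIsomorphic_of_eq (by rw [normalForm, neg_zero])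

theorem K25_isIsomorphic (r : ℝ) :
    IsIsomorphic (K25 0 0 r) (AlmostAbelianAlgebra (normalForm 0 0 0 0 0 0 1 0 r)) := by
  refine isIsomorphic_of_conj
    !![0, 0, 0, 0, 1; 1, 0, 0, 0, 0; 0, 1, 0, 0, 0; 0, 0, 1, 0, 0; 0, 0, 0, 1, 0]
    !![0, 1, 0, 0, 0; 0, 0, 1, 0, 0; 0, 0, 0, 1, 0; 0, 0, 0, 0, 1; 1, 0, 0, 0, 0]
    1 one_ne_zero ?_ ?_
  · ext i j; fin_cases i <;> fin_cases j <;> simp [Matrix.mul_apply, Fin.sum_univ_five]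
  · ext i j; fin_cases i <;> fin_cases j <;>
      simp [normalForm, Matrix.mul_apply, Fin.sum_univ_five]

theorem K15_isIsomorphic :
    IsIsomorphic (K15 0) (AlmostAbelianAlgebra (normalForm 0 0 0 0 0 0 1 0 0)) :=
  (isIsomorphic_of_eq (by rw [neg_zero])).trans (K25_isIsomorphic 0)

theorem K23_isIsomorphic :
    IsIsomorphic (K23 0) (AlmostAbelianAlgebra (normalForm 0 0 0 1 0 0 1 0 0)) := by
  -- `e₄` plays the role of `J e₆`, and `e₃`, `e₅` span the second block.
  refine isIsomorphic_of_conj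
    !![0, 0, 0, 1, 0; 1, 0, 0, 0, 0; 0, 1, 0, 0, 0; 0, 0, 1, 0, 0; 0, 0, 0, 0, 1]
    !![0, 1, 0, 0, 0; 0, 0, 1, 0, 0; 0, 0, 0, 1, 0; 1, 0, 0, 0, 0; 0, 0, 0, 0, 1]
    1 one_ne_zero ?_ ?_
  · ext i j; fin_cases i <;> fin_cases j <;> simp [Matrix.mul_apply, Fin.sum_univ_five]
  · ext i j; fin_cases i <;> fin_cases j <;>
      simp [normalForm, Matrix.mul_apply, Fin.sum_univ_five]

/-! ### The standard Hermitian structure of the normal form -/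

theorem fst_lie_normalForm {a v₁ v₂ v₃ v₄ c α d δ : ℝ}
    (x y : AlmostAbelianAlgebra (normalForm a v₁ v₂ v₃ v₄ c α d δ)) :
    (⁅x, y⁆).1 = ![a * (x.2 * y.1 0 - y.2 * x.1 0),
      v₁ * (x.2 * y.1 0 - y.2 * x.1 0) + c * (x.2 * y.1 1 - y.2 * x.1 1)
        + α * (x.2 * y.1 2 - y.2 * x.1 2),
      v₂ * (x.2 * y.1 0 - y.2 * x.1 0) - α * (x.2 * y.1 1 - y.2 * x.1 1)
        + c * (x.2 * y.1 2 - y.2 * x.1 2),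
      v₃ * (x.2 * y.1 0 - y.2 * x.1 0) + d * (x.2 * y.1 3 - y.2 * x.1 3)
        + δ * (x.2 * y.1 4 - y.2 * x.1 4),
      v₄ * (x.2 * y.1 0 - y.2 * x.1 0) - δ * (x.2 * y.1 3 - y.2 * x.1 3)
        + d * (x.2 * y.1 4 - y.2 * x.1 4)] := by
  rw [fst_lie]
  ext i
  fin_cases i <;> simp [normalForm, dotProduct, Fin.sum_univ_five] <;> ring

variable (a v₁ v₂ v₃ v₄ c α d δ : ℝ)

/-- The standard Hermitian structure: the basis `e₁, …, e₆` is orthonormal and `J e₆ = e₁`,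
`J e₂ = e₃`, `J e₄ = e₅`. -/
def standardHermitian :
    HermitianStructure (AlmostAbelianAlgebra (normalForm a v₁ v₂ v₃ v₄ c α d δ)) where
  J :=
    { toFun := fun x => mk ![x.2, -x.1 2, x.1 1, -x.1 4, x.1 3] (-x.1 0)
      map_add' := fun x y => by
        ext i
        · fin_cases i <;> simp [fst_add, snd_add] <;> ring
        · simp [fst_add, snd_add]; ring
      map_smul' := fun r x => by
        ext i
        · fin_cases i <;> simp [fst_smul, snd_smul]
        · simp [fst_smul, snd_smul] }
  J_J x := by
    ext i
    · fin_cases i <;> simp [fst_neg]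
    · simp [snd_neg]
  integrable x y := by
    ext i
    · fin_cases i <;> simp [fst_sub, fst_zero, snd_lie, fst_lie_normalForm] <;> ring
    · simp [snd_sub, snd_lie, fst_lie_normalForm, snd_zero]
      ring
  metric := LinearMap.mk₂ ℝ
    (fun x y => x.1 0 * y.1 0 + x.1 1 * y.1 1 + x.1 2 * y.1 2 + x.1 3 * y.1 3 + x.1 4 * y.1 4
      + x.2 * y.2)
    (fun _ _ _ => by simp only [fst_add, snd_add, Pi.add_apply]; ring)
    (fun _ _ _ => by simp only [fst_smul, snd_smul, Pi.smul_apply, smul_eq_mul]; ring)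
    (fun _ _ _ => by simp only [fst_add, snd_add, Pi.add_apply]; ring)
    (fun _ _ _ => by simp only [fst_smul, snd_smul, Pi.smul_apply, smul_eq_mul]; ring)
  metric_symm x y := by simp only [LinearMap.mk₂_apply]; ring
  metric_pos x hx := by
    rw [LinearMap.mk₂_apply]
    by_contra! h
    apply hx
    ext i
    · fin_cases i <;> simp only [fst_zero, Pi.zero_apply] <;>
        apply pow_eq_zero_iff two_ne_zero |>.1 <;> simp <;>
        nlinarith [sq_nonneg (x.1 0), sq_nonneg (x.1 1), sq_nonneg (x.1 2), sq_nonneg (x.1 3),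
          sq_nonneg (x.1 4), sq_nonneg x.2]
    · simp only [snd_zero]
      apply pow_eq_zero_iff two_ne_zero |>.1
      nlinarith [sq_nonneg (x.1 0), sq_nonneg (x.1 1), sq_nonneg (x.1 2), sq_nonneg (x.1 3),
        sq_nonneg (x.1 4), sq_nonneg x.2]
  metric_J x y := by simp; ring

end AlmostAbelianAlgebra

namespace AlmostAbelianAlgebra

variable (a v₁ v₂ v₃ v₄ c α d δ : ℝ)

theorem standardHermitian_isKahler :
    (standardHermitian a 0 0 0 0 0 α 0 δ).IsKahler := by
  intro x y z
  simp [d₂, HermitianStructure.fundamentalForm, standardHermitian, fst_lie_normalForm, snd_lie]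
  ring

theorem standardHermitian_isSKT (hc : c = 0 ∨ c = -a / 2) (hd : d = 0 ∨ d = -a / 2) :
    (standardHermitian a v₁ v₂ v₃ v₄ c α d δ).IsSKT := by
  intro x y z w
  simp [d₃, HermitianStructure.dcFundamentalForm, d₂, HermitianStructure.fundamentalForm,
    standardHermitian, fst_lie_normalForm, snd_lie]
  rcases hc with rfl | rfl <;> rcases hd with rfl | rfl <;> ring

end AlmostAbelianAlgebra

namespace AlmostAbelianAlgebra

/-! ### Obstructions to the Kähler condition and to non-nilpotency -/

/-- An eigenvalue `c ± ib` of `ad E` with non-zero real part on a plane does not occur in the normal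
form of a Kähler algebra, where `ad E` is skew-symmetric off a line. -/
theorem not_linearIndependent_of_kahler_normalForm {a α δ b c : ℝ} (hc : c ≠ 0)
    {E X Y : AlmostAbelianAlgebra (normalForm a 0 0 0 0 0 α 0 δ)}
    (hX : ⁅E, X⁆ = c • X - b • Y) (hY : ⁅E, Y⁆ = b • X + c • Y) :
    ¬ LinearIndependent ℝ ![X, Y] := by
  have hX2 := congrArg Prod.snd hX
  have hY2 := congrArg Prod.snd hY
  change _ = (c • X - b • Y).2 at hX2
  change _ = (b • X + c • Y).2 at hY2
  rw [snd_lie, snd_sub, snd_smul, snd_smul] at hX2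
  rw [snd_lie, snd_add, snd_smul, snd_smul] at hY2
  have hcb : c ^ 2 + b ^ 2 ≠ 0 := by positivity
  have x2 : X.2 = 0 := by
    refine (mul_eq_zero.1 ?_).resolve_left hcb
    linear_combination -c * hX2 - b * hY2
  have y2 : Y.2 = 0 := by
    refine (mul_eq_zero.1 ?_).resolve_left hcb
    linear_combination b * hX2 - c * hY2
  have key (i : Fin 5) : (⁅E, X⁆).1 i = c * X.1 i - b * Y.1 i ∧
      (⁅E, Y⁆).1 i = b * X.1 i + c * Y.1 i := by
    rw [hX, hY]
    exact ⟨rfl, rfl⟩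
  simp only [fst_lie_normalForm, x2, y2] at key
  have k1 := key 1
  have k2 := key 2
  have k3 := key 3
  have k4 := key 4
  simp at k1 k2 k3 k4
  obtain ⟨p1, q1⟩ := k1
  obtain ⟨p2, q2⟩ := k2
  obtain ⟨p3, q3⟩ := k3
  obtain ⟨p4, q4⟩ := k4
  -- pairing with `(X, Y)` kills the skew-symmetric part
  have n1 : X.1 1 ^ 2 + X.1 2 ^ 2 + Y.1 1 ^ 2 + Y.1 2 ^ 2 = 0 := by
    refine (mul_eq_zero.1 ?_).resolve_left hc
    linear_combination -X.1 1 * p1 - X.1 2 * p2 - Y.1 1 * q1 - Y.1 2 * q2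
  have n2 : X.1 3 ^ 2 + X.1 4 ^ 2 + Y.1 3 ^ 2 + Y.1 4 ^ 2 = 0 := by
    refine (mul_eq_zero.1 ?_).resolve_left hc
    linear_combination -X.1 3 * p3 - X.1 4 * p4 - Y.1 3 * q3 - Y.1 4 * q4
  have four_sq {p q r s : ℝ} (h : p ^ 2 + q ^ 2 + r ^ 2 + s ^ 2 = 0) :
      p = 0 ∧ q = 0 ∧ r = 0 ∧ s = 0 := by
    refine ⟨?_, ?_, ?_, ?_⟩ <;> refine pow_eq_zero_iff two_ne_zero |>.1 ?_ <;>
      linarith [sq_nonneg p, sq_nonneg q, sq_nonneg r, sq_nonneg s]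
  obtain ⟨x1, x2', y1, y2'⟩ := four_sq n1
  obtain ⟨x3, x4, y3, y4⟩ := four_sq n2
  have hX1 : ∀ i, i ≠ 0 → X.1 i = 0 ∧ Y.1 i = 0 := by
    intro i hi
    fin_cases i
    · exact absurd rfl hi
    · exact ⟨x1, y1⟩
    · exact ⟨x2', y2'⟩
    · exact ⟨x3, y3⟩
    · exact ⟨x4, y4⟩
  intro hli
  rw [LinearIndependent.pair_iff] at hli
  have hrel : Y.1 0 • X + (-X.1 0) • Y = 0 := by
    ext i
    · by_cases hi : i = 0
      · subst hi
        simp [fst_add, fst_smul, fst_zero, fst_neg]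
        ring
      · simp [fst_add, fst_smul, fst_zero, fst_neg, hX1 i hi]
    · simp [snd_add, snd_smul, snd_zero, snd_neg, x2, y2]
  have h0 := neg_eq_zero.1 (hli _ _ hrel).2
  have hX0 : X = 0 := by
    ext i
    · by_cases hi : i = 0
      · subst hi; exact h0
      · exact (hX1 i hi).1
    · exact x2
  simpa using (hli 1 0 (by simp [hX0])).1

theorem not_isIsomorphic_kahler_of_ne_zero {a v₁ v₂ v₃ v₄ c α d δ a' α' δ' : ℝ} (hc : c ≠ 0) :
    ¬ IsIsomorphic (AlmostAbelianAlgebra (normalForm a v₁ v₂ v₃ v₄ c α d δ))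
      (AlmostAbelianAlgebra (normalForm a' 0 0 0 0 0 α' 0 δ')) := by
  rintro ⟨f⟩
  let x : AlmostAbelianAlgebra (normalForm a v₁ v₂ v₃ v₄ c α d δ) := mk ![0, 1, 0, 0, 0] 0
  let y : AlmostAbelianAlgebra (normalForm a v₁ v₂ v₃ v₄ c α d δ) := mk ![0, 0, 1, 0, 0] 0
  let e : AlmostAbelianAlgebra (normalForm a v₁ v₂ v₃ v₄ c α d δ) := mk 0 1
  have hx : ⁅e, x⁆ = c • x - α • y := by
    ext i
    · rw [fst_lie_normalForm]
      fin_cases i <;> simp [e, x, y, fst_sub, fst_smul]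
    · simp [e, x, y, snd_lie, snd_sub, snd_smul]
  have hy : ⁅e, y⁆ = α • x + c • y := by
    ext i
    · rw [fst_lie_normalForm]
      fin_cases i <;> simp [e, x, y, fst_add, fst_smul]
    · simp [e, x, y, snd_lie, snd_add, snd_smul]
  refine not_linearIndependent_of_kahler_normalForm (E := f e) (X := f x) (Y := f y) (b := α) hc
    ?_ ?_ ?_
  · rw [← LieEquiv.map_lie, hx]; simp
  · rw [← LieEquiv.map_lie, hy]; simp
  · rw [LinearIndependent.pair_iff]
    intro s t hst
    have h : s • x + t • y = 0 := f.injective (by simpa using hst)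
    have h1 := congrFun (congrArg Prod.fst h) 1
    have h2 := congrFun (congrArg Prod.fst h) 2
    change (s • x + t • y).1 1 = 0 at h1
    change (s • x + t • y).1 2 = 0 at h2
    simpa [fst_add, fst_smul, x, y] using And.intro h1 h2

/-- In the normal form of a Kähler algebra `ad E` is semisimple unless it is nilpotent. -/
theorem lie_eq_zero_of_kahler_normalForm {a α δ : ℝ}
    {E X W : AlmostAbelianAlgebra (normalForm a 0 0 0 0 0 α 0 δ)}
    (hX : ⁅E, ⁅E, X⁆⁆ = 0) (hW : ⁅E, ⁅E, W⁆⁆ = -W) (hW0 : W ≠ 0) : ⁅E, X⁆ = 0 := by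
  have hE : E.2 ≠ 0 := by
    intro hE
    apply hW0
    rw [← neg_eq_zero, ← hW]
    ext i
    · rw [fst_lie, snd_lie, hE]; simp [fst_zero]
    · rw [snd_lie]; rfl
  have key (i : Fin 5) : (⁅E, ⁅E, X⁆⁆).1 i = 0 := by rw [hX]; rfl
  have k0 := key 0
  have k1 := key 1
  have k2 := key 2
  have k3 := key 3
  have k4 := key 4
  rw [fst_lie_normalForm, snd_lie] at k0 k1 k2 k3 k4
  simp [hE] at k0 k1 k2 k3 k4
  set z : Fin 5 → ℝ := (⁅E, X⁆).1 with hz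
  have hz' := fst_lie_normalForm E X
  rw [← hz] at hz'
  ext i
  · change z i = 0
    fin_cases i
    · change z 0 = 0
      refine k0.elim (fun h => ?_) id
      rw [hz', h]; simp
    · change z 1 = 0
      refine k2.elim (fun h => ?_) id
      rw [hz', h]; simp
    · change z 2 = 0
      refine k1.elim (fun h => ?_) id
      rw [hz', h]; simp
    · change z 3 = 0
      refine k4.elim (fun h => ?_) id
      rw [hz', h]; simp
    · change z 4 = 0
      refine k3.elim (fun h => ?_) id
      rw [hz', h]; simp
  · rw [snd_lie]; rfl

theorem not_isIsomorphic_kahler_of_jordan {a α δ : ℝ} :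
    ¬ IsIsomorphic (AlmostAbelianAlgebra (normalForm 0 0 0 1 0 0 1 0 0))
      (AlmostAbelianAlgebra (normalForm a 0 0 0 0 0 α 0 δ)) := by
  rintro ⟨f⟩
  let x : AlmostAbelianAlgebra (normalForm 0 0 0 1 0 0 1 0 0) := mk ![1, 0, 0, 0, 0] 0
  let w : AlmostAbelianAlgebra (normalForm 0 0 0 1 0 0 1 0 0) := mk ![0, 1, 0, 0, 0] 0
  let e : AlmostAbelianAlgebra (normalForm 0 0 0 1 0 0 1 0 0) := mk 0 1
  have hx : ⁅e, ⁅e, x⁆⁆ = 0 := by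
    ext i
    · rw [fst_lie_normalForm, fst_lie_normalForm, snd_lie]
      fin_cases i <;> simp [e, x, fst_zero]
    · rw [snd_lie]; rfl
  have hw : ⁅e, ⁅e, w⁆⁆ = -w := by
    ext i
    · rw [fst_lie_normalForm, fst_lie_normalForm, snd_lie]
      fin_cases i <;> simp [e, w, fst_neg]
    · simp [e, w, snd_lie, snd_neg]
  have h := lie_eq_zero_of_kahler_normalForm (E := f e) (X := f x) (W := f w)
    (by rw [← LieEquiv.map_lie, ← LieEquiv.map_lie, hx]; simp)
    (by rw [← LieEquiv.map_lie, ← LieEquiv.map_lie, hw]; simp)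
    (by
      intro h
      have h' : w = 0 := f.injective (by simpa using h)
      have h1 := congrFun (congrArg Prod.fst h') 1
      change (1 : ℝ) = 0 at h1
      exact one_ne_zero h1)
  rw [← LieEquiv.map_lie] at h
  have h' : ⁅e, x⁆ = 0 := f.injective (h.trans (map_zero f).symm)
  have h3 : (⁅e, x⁆).1 3 = 0 := by rw [h']; rfl
  rw [fst_lie_normalForm] at h3
  simp [e, x] at h3

theorem isNilpotent_normalForm (v₁ v₂ v₃ v₄ : ℝ) :
    LieRing.IsNilpotent (AlmostAbelianAlgebra (normalForm 0 v₁ v₂ v₃ v₄ 0 0 0 0)) := by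
  rw [LieAlgebra.isNilpotent_iff_forall (R := ℝ)]
  intro x
  refine ⟨3, ?_⟩
  refine LinearMap.ext fun y => ?_
  simp only [pow_succ, pow_zero, one_mul, Module.End.mul_apply, LieAlgebra.ad_apply,
    LinearMap.zero_apply]
  refine ext (funext fun i => ?_) ?_
  · rw [fst_lie_normalForm, fst_lie_normalForm, snd_lie]
    fin_cases i <;> simp [fst_zero, snd_lie]
  · rw [snd_lie]; rfl

end AlmostAbelianAlgebra

/-! ### Adapted frames -/

/-- An endomorphism commuting with a complex structure has a complex eigenvector. -/
theorem exists_complex_eigenvector {V : Type*} [AddCommGroup V] [Module ℝ V]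
    [FiniteDimensional ℝ V] [Nontrivial V] (J A : V →ₗ[ℝ] V) (hJ : ∀ x, J (J x) = -x)
    (hA : ∀ x, A (J x) = J (A x)) :
    ∃ x : V, x ≠ 0 ∧ ∃ c α : ℝ, A x = c • x + α • J x := by
  let φ : ℂ →ₐ[ℝ] Module.End ℝ V := Complex.liftAux J (LinearMap.ext hJ)
  have hφ (z : ℂ) (x : V) : φ z x = z.re • x + z.im • J x := by
    rw [Complex.liftAux_apply]
    rfl
  let _ : Module ℂ V := Module.compHom V φ.toRingHom
  have hsmul (z : ℂ) (x : V) : z • x = z.re • x + z.im • J x := hφ z x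
  have : IsScalarTower ℝ ℂ V := ⟨fun r z x => by
    rw [hsmul, hsmul]
    simp [mul_smul]⟩
  have : FiniteDimensional ℂ V := FiniteDimensional.right ℝ ℂ V
  let A' : Module.End ℂ V :=
    { toFun := A
      map_add' := map_add A
      map_smul' := fun z x => by simp [hsmul, hA] }
  obtain ⟨μ, hμ⟩ := Module.End.exists_eigenvalue A'
  obtain ⟨x, hx⟩ := hμ.exists_hasEigenvector
  exact ⟨x, hx.2, μ.re, μ.im, (hx.apply_eq_smul).trans (hsmul μ x)⟩

namespace HermitianStructure

variable {L : Type*} [LieRing L] [LieAlgebra ℝ L] (S : HermitianStructure L)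

theorem metric_J_left (x y : L) : S.metric (S.J x) y = -S.metric x (S.J y) := by
  have h := S.metric_J x (S.J y)
  rw [S.J_J, map_neg] at h
  linarith

@[simp]
theorem metric_J_self (x : L) : S.metric x (S.J x) = 0 := by
  have h := S.metric_J_left x x
  rw [S.metric_symm] at h
  linarith

/-- A non-zero vector can be rescaled to unit length. -/
theorem exists_smul_unit (x : L) (hx : x ≠ 0) : ∃ r : ℝ, S.metric (r • x) (r • x) = 1 := by
  have h := S.metric_pos x hx
  refine ⟨(√(S.metric x x))⁻¹, ?_⟩
  simp only [map_smul, LinearMap.smul_apply, smul_eq_mul]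
  have h' := Real.sq_sqrt h.le
  have : √(S.metric x x) ≠ 0 := (Real.sqrt_pos.2 h).ne'
  field_simp
  linarith

theorem exists_orthogonal {n : ℕ} (hn : n < Module.finrank ℝ L) (f : Fin n → L) :
    ∃ x : L, x ≠ 0 ∧ ∀ i, S.metric (f i) x = 0 := by
  have : Module.Finite ℝ L := Module.finite_of_finrank_pos (by omega)
  have h := LinearMap.ker_ne_bot_of_finrank_lt (f := LinearMap.pi fun i => S.metric (f i))
    (by simpa using hn)
  obtain ⟨x, hx, hx0⟩ := Submodule.exists_mem_ne_zero_of_ne_bot h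
  exact ⟨x, hx0, fun i => congrFun (LinearMap.mem_ker.1 hx) i⟩

/-- A hyperplane is the orthogonal complement of a unit vector. -/
theorem exists_unit_normal (I : Submodule ℝ L) [FiniteDimensional ℝ L]
    (hI : Module.finrank ℝ (L ⧸ I) = 1) :
    ∃ e : L, S.metric e e = 1 ∧ ∀ z, z ∈ I ↔ S.metric e z = 0 := by
  have hlt : Module.finrank ℝ (Module.Dual ℝ I) < Module.finrank ℝ L := by
    have := Submodule.finrank_quotient_add_finrank I
    rw [Subspace.dual_finrank_eq]
    omega
  have h := LinearMap.ker_ne_bot_of_finrank_lt 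
    (f := Module.Dual.transpose (R := ℝ) I.subtype ∘ₗ S.metric) hlt
  obtain ⟨e, he, he0⟩ := Submodule.exists_mem_ne_zero_of_ne_bot h
  have he' (z : L) (hz : z ∈ I) : S.metric e z = 0 := by
    have := LinearMap.congr_fun (LinearMap.mem_ker.1 he) ⟨z, hz⟩
    exact this
  obtain ⟨r, hr⟩ := S.exists_smul_unit e he0
  have hr' (z : L) (hz : z ∈ I) : S.metric (r • e) z = 0 := by simp [he' z hz]
  refine ⟨r • e, hr, fun z => ⟨hr' z, fun hz => ?_⟩⟩
  set e' := r • e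
  have hne : (Submodule.Quotient.mk e' : L ⧸ I) ≠ 0 := by
    rw [Ne, Submodule.Quotient.mk_eq_zero]
    intro h
    rw [hr' _ h] at hr
    exact zero_ne_one hr
  obtain ⟨t, ht⟩ := (finrank_eq_one_iff_of_nonzero' _ hne).1 hI (Submodule.Quotient.mk z)
  rw [← Submodule.Quotient.mk_smul, eq_comm, Submodule.Quotient.eq] at ht
  have h0 := hr' _ ht
  rw [map_sub, hz, map_smul, hr] at h0
  have ht0 : t = 0 := by simpa using h0
  simpa [ht0] using ht

/-- `e, J e, x, J x, y, J y` is an orthonormal family. -/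
structure IsUnitaryFrame (e x y : L) : Prop where
  e_e : S.metric e e = 1
  x_x : S.metric x x = 1
  y_y : S.metric y y = 1
  e_x : S.metric e x = 0
  e_Jx : S.metric e (S.J x) = 0
  e_y : S.metric e y = 0
  e_Jy : S.metric e (S.J y) = 0
  x_y : S.metric x y = 0
  x_Jy : S.metric x (S.J y) = 0

namespace IsUnitaryFrame

variable {S} {e x y : L}

theorem x_e (F : S.IsUnitaryFrame e x y) : S.metric x e = 0 := by rw [S.metric_symm, F.e_x]

theorem y_e (F : S.IsUnitaryFrame e x y) : S.metric y e = 0 := by rw [S.metric_symm, F.e_y]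

theorem y_x (F : S.IsUnitaryFrame e x y) : S.metric y x = 0 := by rw [S.metric_symm, F.x_y]

theorem x_Je (F : S.IsUnitaryFrame e x y) : S.metric x (S.J e) = 0 := by
  rw [S.metric_symm, S.metric_J_left, F.e_Jx, neg_zero]

theorem y_Je (F : S.IsUnitaryFrame e x y) : S.metric y (S.J e) = 0 := by
  rw [S.metric_symm, S.metric_J_left, F.e_Jy, neg_zero]

theorem y_Jx (F : S.IsUnitaryFrame e x y) : S.metric y (S.J x) = 0 := by
  rw [S.metric_symm, S.metric_J_left, F.x_Jy, neg_zero]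

end IsUnitaryFrame

end HermitianStructure

namespace HermitianStructure

variable {L : Type*} [LieRing L] [LieAlgebra ℝ L] {S : HermitianStructure L}

namespace IsUnitaryFrame

variable {e x y : L}

theorem coeff_eq_zero (F : S.IsUnitaryFrame e x y) {t₀ t₁ t₂ t₃ t₄ t₅ : ℝ}
    (h : t₀ • e + t₁ • S.J e + t₂ • x + t₃ • S.J x + t₄ • y + t₅ • S.J y = 0) :
    t₀ = 0 ∧ t₁ = 0 ∧ t₂ = 0 ∧ t₃ = 0 ∧ t₄ = 0 ∧ t₅ = 0 := by
  have key (u : L) : S.metric u (t₀ • e + t₁ • S.J e + t₂ • x + t₃ • S.J x + t₄ • y + t₅ • S.J y)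
      = 0 := by rw [h, map_zero]
  have k0 := key e
  have k1 := key (S.J e)
  have k2 := key x
  have k3 := key (S.J x)
  have k4 := key y
  have k5 := key (S.J y)
  simp [metric_J_left, S.J_J, F.e_e, F.x_x, F.y_y, F.e_x, F.e_Jx, F.e_y, F.e_Jy, F.x_y, F.x_Jy,
    F.x_e, F.y_e, F.y_x, F.x_Je, F.y_Je, F.y_Jx] at k0 k1 k2 k3 k4 k5
  exact ⟨k0, k1, k2, k3, k4, k5⟩

/-- In dimension six a unitary frame spans. -/
theorem expand (F : S.IsUnitaryFrame e x y) (hL : Module.finrank ℝ L = 6) (z : L) :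
    z = S.metric e z • e + S.metric (S.J e) z • S.J e + S.metric x z • x
      + S.metric (S.J x) z • S.J x + S.metric y z • y + S.metric (S.J y) z • S.J y := by
  have hfin : Module.Finite ℝ L := Module.finite_of_finrank_pos (by omega)
  have hli : LinearIndependent ℝ ![e, S.J e, x, S.J x, y, S.J y] := by
    rw [Fintype.linearIndependent_iff]
    intro t ht
    simp only [Fin.sum_univ_six] at ht
    obtain ⟨h0, h1, h2, h3, h4, h5⟩ := F.coeff_eq_zero ht
    intro i
    fin_cases i <;> assumption
  have hspan := hli.span_eq_top_of_card_eq_finrank (by simp [hL])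
  have hz : z ∈ Submodule.span ℝ (Set.range ![e, S.J e, x, S.J x, y, S.J y]) := by
    rw [hspan]; trivial
  obtain ⟨t, rfl⟩ := (Submodule.mem_span_range_iff_exists_fun ℝ).1 hz
  simp [Fin.sum_univ_six, metric_J_left, S.J_J, F.e_e, F.x_x, F.y_y, F.e_x, F.e_Jx, F.e_y, F.e_Jy,
    F.x_y, F.x_Jy, F.x_e, F.y_e, F.y_x, F.x_Je, F.y_Je, F.y_Jx]

end IsUnitaryFrame

/-- A unitary frame adapted to an abelian hyperplane `e^⊥`: on the maximal complex subspace
`⟨x, J x, y, J y⟩` of this hyperplane, `ad e` is complex linear and triangular, with eigenvalues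
`c - αi`, `d - δi` and off-diagonal entry `β - γi`. -/
structure IsAdaptedFrame (S : HermitianStructure L) (e x y : L)
    (a v₁ v₂ v₃ v₄ c α d δ β γ : ℝ) : Prop extends S.IsUnitaryFrame e x y where
  abelian : ∀ z w, S.metric e z = 0 → S.metric e w = 0 → ⁅z, w⁆ = 0
  lie_Je : ⁅e, S.J e⁆ = a • S.J e + v₁ • x + v₂ • S.J x + v₃ • y + v₄ • S.J y
  lie_x : ⁅e, x⁆ = c • x - α • S.J x
  lie_Jx : ⁅e, S.J x⁆ = α • x + c • S.J x
  lie_y : ⁅e, y⁆ = β • x - γ • S.J x + d • y - δ • S.J y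
  lie_Jy : ⁅e, S.J y⁆ = γ • x + β • S.J x + δ • y + d • S.J y

theorem exists_isAdaptedFrame (S : HermitianStructure L) (hL : Module.finrank ℝ L = 6)
    (hA : IsAlmostAbelian L) :
    ∃ (e x y : L) (a v₁ v₂ v₃ v₄ c α d δ β γ : ℝ),
      S.IsAdaptedFrame e x y a v₁ v₂ v₃ v₄ c α d δ β γ := by
  have hfin : Module.Finite ℝ L := Module.finite_of_finrank_pos (by omega)
  obtain ⟨I, hIab, hI⟩ := hA
  obtain ⟨e, he, heI⟩ := S.exists_unit_normal I.toSubmodule hI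
  have hab (z w : L) (hz : S.metric e z = 0) (hw : S.metric e w = 0) : ⁅z, w⁆ = 0 := by
    have h := trivial_lie_zero I I ⟨z, (heI z).2 hz⟩ ⟨w, (heI w).2 hw⟩
    exact congrArg Subtype.val h
  have hlie (z : L) (hz : S.metric e z = 0) : S.metric e ⁅e, z⁆ = 0 :=
    (heI _).1 (lie_mem_right ℝ L I e z ((heI z).2 hz))
  -- On the maximal complex subspace, integrability says that `ad e` is complex linear.
  have hJ (z : L) (hz : S.metric e z = 0) (hz' : S.metric e (S.J z) = 0) :
      ⁅e, S.J z⁆ = S.J ⁅e, z⁆ := by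
    have h := S.integrable e z
    rw [hab _ _ (S.metric_J_self e) hz', hab _ _ (S.metric_J_self e) hz, map_zero, sub_zero,
      zero_sub, sub_eq_zero, neg_eq_iff_eq_neg] at h
    have h' := congrArg S.J h
    rw [S.J_J, map_neg] at h'
    exact neg_injective h'
  let V : Submodule ℝ L := LinearMap.ker (S.metric e) ⊓ LinearMap.ker (S.metric e ∘ₗ S.J)
  have hV (z : L) : z ∈ V ↔ S.metric e z = 0 ∧ S.metric e (S.J z) = 0 := Iff.rfl
  have hVJ : ∀ z ∈ V, S.J z ∈ V := fun z hz => by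
    rw [hV] at hz ⊢
    rw [S.J_J, map_neg, hz.1]
    exact ⟨hz.2, neg_zero⟩
  have hVe : ∀ z ∈ V, LieAlgebra.ad ℝ L e z ∈ V := fun z hz => by
    have hz1 := (hV _).1 hz
    rw [hV, LieAlgebra.ad_apply, ← hJ z hz1.1 hz1.2]
    exact ⟨hlie _ hz1.1, hlie _ hz1.2⟩
  have hVnt : Nontrivial V := by
    obtain ⟨z, hz0, hz⟩ := S.exists_orthogonal (n := 2) (by omega) ![e, S.J e]
    have h0 : S.metric e z = 0 := hz 0
    have h1 : S.metric (S.J e) z = 0 := hz 1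
    rw [metric_J_left, neg_eq_zero] at h1
    exact ⟨⟨⟨z, h0, h1⟩, 0, fun h => hz0 (congrArg Subtype.val h)⟩⟩
  obtain ⟨⟨x₀, hx₀⟩, hx₀0, c, α, hx₀e⟩ := exists_complex_eigenvector
    (S.J.restrict hVJ) ((LieAlgebra.ad ℝ L e).restrict hVe)
    (fun z => Subtype.ext (S.J_J z)) (fun z => Subtype.ext (hJ z z.2.1 z.2.2))
  replace hx₀e : ⁅e, x₀⁆ = c • x₀ + α • S.J x₀ := congrArg Subtype.val hx₀e
  replace hx₀0 : x₀ ≠ 0 := fun h => hx₀0 (Subtype.ext h)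
  obtain ⟨r, hr⟩ := S.exists_smul_unit x₀ hx₀0
  obtain ⟨x, hx⟩ : ∃ x, x = r • x₀ := ⟨_, rfl⟩
  rw [← hx] at hr
  have hxe : ⁅e, x⁆ = c • x + α • S.J x := by
    rw [hx, lie_smul, hx₀e, map_smul]
    module
  have hxV : x ∈ V := hx ▸ V.smul_mem r hx₀
  obtain ⟨y₀, hy₀0, hy₀⟩ := S.exists_orthogonal (n := 4) (by omega) ![e, S.J e, x, S.J x]
  obtain ⟨s, hs⟩ := S.exists_smul_unit y₀ hy₀0
  have hy (i : Fin 4) : S.metric (![e, S.J e, x, S.J x] i) (s • y₀) = 0 := by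
    rw [map_smul, hy₀, smul_zero]
  set y := s • y₀
  have hy0 : S.metric e y = 0 := hy 0
  have hy1 : S.metric (S.J e) y = 0 := hy 1
  have hy2 : S.metric x y = 0 := hy 2
  have hy3 : S.metric (S.J x) y = 0 := hy 3
  rw [metric_J_left, neg_eq_zero] at hy1 hy3
  have F : S.IsUnitaryFrame e x y := ⟨he, hr, hs, hxV.1, hxV.2, hy0, hy1, hy2, hy3⟩
  have hey := F.expand hL ⁅e, y⁆
  rw [hlie y hy0, show S.metric (S.J e) ⁅e, y⁆ = 0 by
    rw [metric_J_left, ← hJ y hy0 hy1, hlie _ hy1, neg_zero]] at hey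
  have heJ := F.expand hL ⁅e, S.J e⁆
  rw [hlie _ (S.metric_J_self e)] at heJ
  refine ⟨e, x, y, _, _, _, _, _, c, -α, _, -S.metric (S.J y) ⁅e, y⁆, _,
    -S.metric (S.J x) ⁅e, y⁆, { F with
      abelian := hab
      lie_Je := heJ.trans (by module)
      lie_x := hxe.trans (by module)
      lie_Jx := ?_
      lie_y := hey.trans (by module)
      lie_Jy := ?_ }⟩
  · rw [hJ x hxV.1 hxV.2, hxe, map_add, map_smul, map_smul, S.J_J]
    module
  · rw [hJ y hy0 hy1]
    nth_rewrite 1 [hey]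
    simp only [map_add, map_smul, S.J_J]
    module

end HermitianStructure

/-! ### The SKT and Kähler equations in an adapted frame -/

namespace HermitianStructure

variable {L : Type*} [LieRing L] [LieAlgebra ℝ L] {S : HermitianStructure L}

namespace IsAdaptedFrame

variable {e x y : L} {a v₁ v₂ v₃ v₄ c α d δ β γ : ℝ}

theorem isIsomorphic (F : S.IsAdaptedFrame e x y a v₁ v₂ v₃ v₄ c α d δ 0 0)
    (hL : Module.finrank ℝ L = 6) :
    IsIsomorphic L
      (AlmostAbelianAlgebra (AlmostAbelianAlgebra.normalForm a v₁ v₂ v₃ v₄ c α d δ)) := by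
  refine AlmostAbelianAlgebra.isIsomorphic_of_frame hL ![S.J e, x, S.J x, y, S.J y] e ?_ ?_ ?_
  · intro r t h
    simp only [Fin.sum_univ_five] at h
    obtain ⟨h0, h1, h2, h3, h4, h5⟩ := F.coeff_eq_zero (t₀ := t) (t₁ := r 0) (t₂ := r 1)
      (t₃ := r 2) (t₄ := r 3) (t₅ := r 4) (Eq.trans (by simp; abel) h)
    refine ⟨funext fun i => ?_, h0⟩
    fin_cases i <;> assumption
  · have hperp : ∀ i, S.metric e (![S.J e, x, S.J x, y, S.J y] i) = 0 := by
      intro i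
      fin_cases i <;> simp [F.e_x, F.e_Jx, F.e_y, F.e_Jy]
    exact fun i j => F.abelian _ _ (hperp i) (hperp j)
  · intro j
    rw [Fin.sum_univ_five]
    fin_cases j
    · simpa [AlmostAbelianAlgebra.normalForm] using F.lie_Je
    · simpa [AlmostAbelianAlgebra.normalForm, sub_eq_add_neg] using F.lie_x
    · simpa [AlmostAbelianAlgebra.normalForm] using F.lie_Jx
    · simpa [AlmostAbelianAlgebra.normalForm, sub_eq_add_neg] using F.lie_y
    · simpa [AlmostAbelianAlgebra.normalForm] using F.lie_Jy

theorem kahler (F : S.IsAdaptedFrame e x y a v₁ v₂ v₃ v₄ c α d δ β γ) (h : S.IsKahler) :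
    v₁ = 0 ∧ v₂ = 0 ∧ v₃ = 0 ∧ v₄ = 0 ∧ c = 0 ∧ d = 0 := by
  have U := F.toIsUnitaryFrame
  have b1 := F.abelian _ _ (S.metric_J_self e) F.e_x
  have b2 := F.abelian _ _ (S.metric_J_self e) F.e_Jx
  have b3 := F.abelian _ _ (S.metric_J_self e) F.e_y
  have b4 := F.abelian _ _ (S.metric_J_self e) F.e_Jy
  have b5 := F.abelian _ _ F.e_x F.e_Jx
  have b6 := F.abelian _ _ F.e_y F.e_Jy
  have k1 := h e (S.J e) x
  have k2 := h e (S.J e) (S.J x)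
  have k3 := h e (S.J e) y
  have k4 := h e (S.J e) (S.J y)
  have k5 := h e x (S.J x)
  have k6 := h e y (S.J y)
  simp [d₂, fundamentalForm, F.lie_Je, F.lie_x, F.lie_Jx, F.lie_y, F.lie_Jy, b1, b2, b3, b4, b5, b6,
    metric_J_left, S.J_J, F.x_x, F.y_y, F.e_x, F.e_Jx, F.e_y, F.e_Jy, F.x_y, F.x_Jy,
    U.x_e, U.y_e, U.y_x, U.x_Je, U.y_Je, U.y_Jx] at k1 k2 k3 k4 k5 k6
  refine ⟨?_, ?_, ?_, ?_, ?_, ?_⟩ <;> linarith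

/-- The SKT condition evaluated on `(e, J e, x, J x)`, `(e, J e, y, J y)`, `(e, J e, x, y)` and
`(e, J e, x, J y)`. -/
theorem skt_equations (F : S.IsAdaptedFrame e x y a v₁ v₂ v₃ v₄ c α d δ β γ) (h : S.IsSKT) :
    c * (2 * c + a) = 0 ∧ d * (2 * d + a) + β ^ 2 + γ ^ 2 = 0 ∧
    (a + 3 * c + d) * β + (α - δ) * γ = 0 ∧ (a + 3 * c + d) * γ - (α - δ) * β = 0 := by
  have U := F.toIsUnitaryFrame
  have b1 := F.abelian _ _ (S.metric_J_self e) F.e_x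
  have b2 := F.abelian _ _ (S.metric_J_self e) F.e_Jx
  have b3 := F.abelian _ _ (S.metric_J_self e) F.e_y
  have b4 := F.abelian _ _ (S.metric_J_self e) F.e_Jy
  have b5 := F.abelian _ _ F.e_x F.e_Jx
  have b6 := F.abelian _ _ F.e_y F.e_Jy
  have b7 := F.abelian _ _ F.e_x F.e_y
  have b8 := F.abelian _ _ F.e_x F.e_Jy
  have b9 := F.abelian _ _ F.e_Jx F.e_y
  have b10 := F.abelian _ _ F.e_Jx F.e_Jy
  have sk (z w : L) (h : ⁅z, w⁆ = 0) : ⁅w, z⁆ = 0 := by rw [← lie_skew, h, neg_zero]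
  have r (z : L) : ⁅z, e⁆ = -⁅e, z⁆ := (lie_skew _ _).symm
  have k1 := h e (S.J e) x (S.J x)
  have k2 := h e (S.J e) y (S.J y)
  have k3 := h e (S.J e) x y
  have k4 := h e (S.J e) x (S.J y)
  simp [d₃, dcFundamentalForm, d₂, fundamentalForm, F.lie_Je, F.lie_x, F.lie_Jx, F.lie_y, F.lie_Jy,
    b1, b2, b3, b4, b5, b6, b7, b8, b9, b10, sk _ _ b5, sk _ _ b6, sk _ _ b7, sk _ _ b8, sk _ _ b9,
    sk _ _ b10, r, metric_J_left, S.J_J, F.x_x, F.y_y, F.x_y, F.x_Jy, U.y_x, U.y_Jx] at k1 k2 k3 k4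
  refine ⟨?_, ?_, ?_, ?_⟩ <;> linarith

theorem skt (F : S.IsAdaptedFrame e x y a v₁ v₂ v₃ v₄ c α d δ β γ) (h : S.IsSKT) :
    (c = 0 ∨ c = -a / 2) ∧ (d = 0 ∨ d = -a / 2) ∧ β = 0 ∧ γ = 0 := by
  obtain ⟨h1, h2, h3, h4⟩ := F.skt_equations h
  have hc : c = 0 ∨ c = -a / 2 := (mul_eq_zero.1 h1).imp_right fun h => by linarith
  -- The two off-diagonal equations form a rotation-dilation applied to `(β, γ)`.
  have h5 : (a + 3 * c + d) * (β ^ 2 + γ ^ 2) = 0 := by linear_combination β * h3 + γ * h4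
  have h6 : β ^ 2 + γ ^ 2 = 0 := by
    refine (mul_eq_zero.1 h5).elim (fun hd => ?_) id
    have hd' : d = -a - 3 * c := by linarith
    rw [hd'] at h2
    rcases hc with rfl | rfl <;> nlinarith [sq_nonneg a, sq_nonneg β, sq_nonneg γ]
  rw [add_assoc, h6, add_zero] at h2
  refine ⟨hc, (mul_eq_zero.1 h2).imp_right fun h => by linarith, ?_, ?_⟩ <;>
    nlinarith [sq_nonneg β, sq_nonneg γ]

end IsAdaptedFrame

end HermitianStructure

section NormalForm

open AlmostAbelianAlgebra

variable {L : Type*} [LieRing L] [LieAlgebra ℝ L]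

theorem AdmitsSKT.exists_normalForm (h : AdmitsSKT L) (hL : Module.finrank ℝ L = 6)
    (hA : IsAlmostAbelian L) :
    ∃ a v₁ v₂ v₃ v₄ c α d δ : ℝ, (c = 0 ∨ c = -a / 2) ∧ (d = 0 ∨ d = -a / 2) ∧
      IsIsomorphic L (AlmostAbelianAlgebra (normalForm a v₁ v₂ v₃ v₄ c α d δ)) := by
  obtain ⟨S, hS⟩ := h
  obtain ⟨e, x, y, a, v₁, v₂, v₃, v₄, c, α, d, δ, β, γ, F⟩ := S.exists_isAdaptedFrame hL hA
  obtain ⟨hc, hd, rfl, rfl⟩ := F.skt hS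
  exact ⟨a, v₁, v₂, v₃, v₄, c, α, d, δ, hc, hd, F.isIsomorphic hL⟩

theorem AdmitsKahler.exists_normalForm (h : AdmitsKahler L) (hL : Module.finrank ℝ L = 6)
    (hA : IsAlmostAbelian L) :
    ∃ a α δ : ℝ, IsIsomorphic L (AlmostAbelianAlgebra (normalForm a 0 0 0 0 0 α 0 δ)) := by
  obtain ⟨S, hS⟩ := h
  obtain ⟨e, x, y, a, v₁, v₂, v₃, v₄, c, α, d, δ, β, γ, F⟩ := S.exists_isAdaptedFrame hL hA
  obtain ⟨-, -, rfl, rfl⟩ := F.skt hS.isSKT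
  obtain ⟨rfl, rfl, rfl, rfl, rfl, rfl⟩ := F.kahler hS
  exact ⟨a, α, δ, F.isIsomorphic hL⟩

end NormalForm

open AlmostAbelianAlgebra

/-! ### The classification -/

section Classification

variable {L : Type*} [LieRing L] [LieAlgebra ℝ L]

theorem IsIsomorphic.isNilpotent {L' : Type*} [LieRing L'] [LieAlgebra ℝ L']
    (h : IsIsomorphic L L') (h' : LieRing.IsNilpotent L') : LieRing.IsNilpotent L :=
  h.elim fun f => f.nilpotent_iff_equiv_nilpotent.2 h'

/-- The two blocks can be ordered by the size of their imaginary parts. -/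
theorem IsIsomorphic.exists_abs_le {a v₁ v₂ v₃ v₄ c α d δ : ℝ}
    (h : IsIsomorphic L (AlmostAbelianAlgebra (normalForm a v₁ v₂ v₃ v₄ c α d δ))) :
    ∃ v₁' v₂' v₃' v₄' c' α' d' δ' : ℝ, |δ'| ≤ |α'| ∧ ((c' = c ∧ d' = d) ∨ (c' = d ∧ d' = c)) ∧
      (v₁ = 0 ∧ v₂ = 0 ∧ v₃ = 0 ∧ v₄ = 0 → v₁' = 0 ∧ v₂' = 0 ∧ v₃' = 0 ∧ v₄' = 0) ∧
      IsIsomorphic L (AlmostAbelianAlgebra (normalForm a v₁' v₂' v₃' v₄' c' α' d' δ')) := by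
  rcases le_total |δ| |α| with hle | hle
  · exact ⟨v₁, v₂, v₃, v₄, c, α, d, δ, hle, .inl ⟨rfl, rfl⟩, id, h⟩
  · exact ⟨v₃, v₄, v₁, v₂, d, δ, c, α, hle, .inr ⟨rfl, rfl⟩,
      fun ⟨h1, h2, h3, h4⟩ => ⟨h3, h4, h1, h2⟩, h.trans (normalForm_swap _ _ _ _ _ _ _ _ _)⟩

/-- Division by the imaginary part of the first block. -/
theorem IsIsomorphic.scale_first {a c α d δ : ℝ}
    (h : IsIsomorphic L (AlmostAbelianAlgebra (normalForm a 0 0 0 0 c α d δ))) (hα : α ≠ 0) :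
    IsIsomorphic L
      (AlmostAbelianAlgebra (normalForm (a / α) 0 0 0 0 (c / α) 1 (d / α) (δ / α))) :=
  (h.trans (normalForm_scale _ _ _ _ _ _ _ _ _ α hα)).trans
    (isIsomorphic_of_eq (by simp [hα]))

theorem IsIsomorphic.scale_second {a c α d δ : ℝ}
    (h : IsIsomorphic L (AlmostAbelianAlgebra (normalForm a 0 0 0 0 c α d δ))) (hδ : δ ≠ 0) :
    IsIsomorphic L
      (AlmostAbelianAlgebra (normalForm (a / δ) 0 0 0 0 (c / δ) (α / δ) (d / δ) 1)) :=
  (h.trans (normalForm_scale _ _ _ _ _ _ _ _ _ δ hδ)).trans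
    (isIsomorphic_of_eq (by simp [hδ]))

theorem IsIsomorphic.scale_real {a c d : ℝ}
    (h : IsIsomorphic L (AlmostAbelianAlgebra (normalForm a 0 0 0 0 c 0 d 0))) (ha : a ≠ 0) :
    IsIsomorphic L (AlmostAbelianAlgebra (normalForm 1 0 0 0 0 (c / a) 0 (d / a) 0)) :=
  (h.trans (normalForm_scale _ _ _ _ _ _ _ _ _ a ha)).trans
    (isIsomorphic_of_eq (by simp [ha]))

theorem abs_div_le_one_of_abs_le {α δ : ℝ} (h : |δ| ≤ |α|) : |δ / α| ≤ 1 := by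
  rw [abs_div]
  exact div_le_one_of_le₀ h (abs_nonneg _)

theorem admitsKahler_of_normalForm {a α δ : ℝ}
    (h : IsIsomorphic L (AlmostAbelianAlgebra (normalForm a 0 0 0 0 0 α 0 δ))) :
    AdmitsKahler L :=
  h.admitsKahler ⟨_, standardHermitian_isKahler a α δ⟩

theorem admitsSKT_of_normalForm {a v₁ v₂ v₃ v₄ c α d δ : ℝ}
    (h : IsIsomorphic L (AlmostAbelianAlgebra (normalForm a v₁ v₂ v₃ v₄ c α d δ)))
    (hc : c = 0 ∨ c = -a / 2) (hd : d = 0 ∨ d = -a / 2) : AdmitsSKT L :=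
  h.admitsSKT ⟨_, standardHermitian_isSKT a v₁ v₂ v₃ v₄ c α d δ hc hd⟩

theorem admitsKahler_iff (hL : Module.finrank ℝ L = 6) (hA : IsAlmostAbelian L)
    (hN : ¬ LieRing.IsNilpotent L) :
    AdmitsKahler L ↔
      (∃ p s : ℝ, p ≠ 0 ∧ 0 < |s| ∧ |s| ≤ 1 ∧ IsIsomorphic L (K11 p 0 0 s)) ∨
      IsIsomorphic L K13 ∨
      IsIsomorphic L (K15 0) ∨
      (∃ p : ℝ, p ≠ 0 ∧ IsIsomorphic L (K19 p 0)) ∨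
      (∃ r : ℝ, 0 < |r| ∧ |r| ≤ 1 ∧ IsIsomorphic L (K25 0 0 r)) := by
  constructor
  · intro hK
    obtain ⟨a, α₀, δ₀, h₀⟩ := hK.exists_normalForm hL hA
    obtain ⟨v₁, v₂, v₃, v₄, c, α, d, δ, hle, hcd, hv, h⟩ := h₀.exists_abs_le
    obtain ⟨rfl, rfl, rfl, rfl⟩ := hv ⟨rfl, rfl, rfl, rfl⟩
    obtain ⟨rfl, rfl⟩ : c = 0 ∧ d = 0 := by rcases hcd with h | h <;> exact h
    by_cases hα : α = 0
    · subst hα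
      obtain rfl : δ = 0 := by simpa using hle
      by_cases ha : a = 0
      · subst ha
        exact absurd (h.isNilpotent (isNilpotent_normalForm 0 0 0 0)) hN
      · have h' := h.scale_real ha
        rw [zero_div] at h'
        exact .inr (.inl (h'.trans K13_isIsomorphic.symm))
    · have h' := h.scale_first hα
      have hs := abs_div_le_one_of_abs_le hle
      rw [zero_div] at h'
      by_cases ha : a = 0
      · rw [ha, zero_div] at h'
        by_cases hδ : δ = 0
        · rw [hδ, zero_div] at h'
          exact .inr (.inr (.inl (h'.trans K15_isIsomorphic.symm)))
        · exact .inr (.inr (.inr (.inr ⟨δ / α, abs_pos.2 (div_ne_zero hδ hα), hs,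
            h'.trans (K25_isIsomorphic _).symm⟩)))
      · by_cases hδ : δ = 0
        · rw [hδ, zero_div] at h'
          exact .inr (.inr (.inr (.inl ⟨a / α, div_ne_zero ha hα,
            h'.trans (K19_isIsomorphic _ _).symm⟩)))
        · exact .inl ⟨a / α, δ / α, div_ne_zero ha hα, abs_pos.2 (div_ne_zero hδ hα), hs,
            h'.trans (K11_isIsomorphic _ _ _ _).symm⟩
  · rintro (⟨p, s, -, -, -, h⟩ | h | h | ⟨p, -, h⟩ | ⟨r, -, -, h⟩)
    · exact admitsKahler_of_normalForm (h.trans (K11_isIsomorphic _ _ _ _))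
    · exact admitsKahler_of_normalForm (h.trans K13_isIsomorphic)
    · exact admitsKahler_of_normalForm (h.trans K15_isIsomorphic)
    · exact admitsKahler_of_normalForm (h.trans (K19_isIsomorphic _ _))
    · exact admitsKahler_of_normalForm (h.trans (K25_isIsomorphic _))

theorem not_admitsKahler_of_ne_zero (hL : Module.finrank ℝ L = 6) (hA : IsAlmostAbelian L)
    {a v₁ v₂ v₃ v₄ c α d δ : ℝ} (hc : c ≠ 0)
    (h : IsIsomorphic L (AlmostAbelianAlgebra (normalForm a v₁ v₂ v₃ v₄ c α d δ))) :
    ¬ AdmitsKahler L := by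
  intro hK
  obtain ⟨a', α', δ', h'⟩ := hK.exists_normalForm hL hA
  exact not_isIsomorphic_kahler_of_ne_zero hc (h.symm.trans h')

theorem not_admitsKahler_of_jordan (hL : Module.finrank ℝ L = 6) (hA : IsAlmostAbelian L)
    (h : IsIsomorphic L (AlmostAbelianAlgebra (normalForm 0 0 0 1 0 0 1 0 0))) :
    ¬ AdmitsKahler L := by
  intro hK
  obtain ⟨a', α', δ', h'⟩ := hK.exists_normalForm hL hA
  exact not_isIsomorphic_kahler_of_jordan (h.symm.trans h')

/-- For `a = 0` both blocks are skew-symmetric, and only a Jordan block for the eigenvalue `0`, made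
by a non-zero `v` over a vanishing block, can obstruct a Kähler structure. -/
theorem isIsomorphic_K23_of_normalForm {v₁ v₂ v₃ v₄ α δ : ℝ}
    (h : IsIsomorphic L (AlmostAbelianAlgebra (normalForm 0 v₁ v₂ v₃ v₄ 0 α 0 δ)))
    (hN : ¬ LieRing.IsNilpotent L) (hK : ¬ AdmitsKahler L) : IsIsomorphic L (K23 0) := by
  obtain ⟨v₁, v₂, v₃, v₄, c, α, d, δ, hle, hcd, -, h⟩ := h.exists_abs_le
  obtain ⟨rfl, rfl⟩ : c = 0 ∧ d = 0 := by rcases hcd with h | h <;> exact h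
  by_cases hα : α = 0
  · subst hα
    obtain rfl : δ = 0 := by simpa using hle
    exact absurd (h.isNilpotent (isNilpotent_normalForm _ _ _ _)) hN
  have hα' : ((0 : ℝ) - 0) ^ 2 + α ^ 2 ≠ 0 := by positivity
  by_cases hδ : δ = 0
  · subst hδ
    have h' := h.trans (normalForm_remove _ _ _ _ _ _ _ _ _ hα')
    by_cases hv : v₃ = 0 ∧ v₄ = 0
    · obtain ⟨rfl, rfl⟩ := hv
      exact absurd (admitsKahler_of_normalForm h') hK
    · have h'' := h'.trans (normalForm_scale _ _ _ _ _ _ _ _ _ α hα)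
      rw [div_self hα, zero_div] at h''
      refine (h''.trans (normalForm_normalize _ _ _ _ _ _ ?_)).trans K23_isIsomorphic.symm
      simpa [hα, or_iff_not_and_not] using hv
  · have hδ' : ((0 : ℝ) - 0) ^ 2 + δ ^ 2 ≠ 0 := by positivity
    exact absurd (admitsKahler_of_normalForm
      (h.trans (normalForm_remove_both _ _ _ _ _ _ _ _ _ hα' hδ'))) hK

theorem isIsomorphic_of_both_blocks {a α δ : ℝ} (ha : a ≠ 0)
    (h : IsIsomorphic L (AlmostAbelianAlgebra (normalForm a 0 0 0 0 (-a / 2) α (-a / 2) δ))) :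
    IsIsomorphic L (K1 (-1 / 2) (-1 / 2)) ∨
      (∃ p : ℝ, p ≠ 0 ∧ IsIsomorphic L (K8 p (-p / 2) (-p / 2))) ∨
      (∃ p s : ℝ, p ≠ 0 ∧ 0 < |s| ∧ |s| ≤ 1 ∧ IsIsomorphic L (K11 p (-p / 2) (-p / 2) s)) := by
  obtain ⟨v₁, v₂, v₃, v₄, c, α, d, δ, hle, hcd, hv, h⟩ := h.exists_abs_le
  obtain ⟨rfl, rfl, rfl, rfl⟩ := hv ⟨rfl, rfl, rfl, rfl⟩
  obtain ⟨rfl, rfl⟩ : c = -a / 2 ∧ d = -a / 2 := by rcases hcd with h | h <;> exact h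
  by_cases hα : α = 0
  · subst hα
    obtain rfl : δ = 0 := by simpa using hle
    have h' := h.scale_real ha
    rw [show -a / 2 / a = -1 / 2 by field_simp] at h'
    exact .inl (h'.trans (K1_isIsomorphic _ _).symm)
  have h' := h.scale_first hα
  have hs := abs_div_le_one_of_abs_le hle
  have hp := div_ne_zero ha hα
  rw [show -a / 2 / α = -(a / α) / 2 by ring] at h'
  by_cases hδ : δ = 0
  · rw [hδ, zero_div] at h'
    exact .inr (.inl ⟨a / α, hp, (h'.trans (normalForm_swap _ _ _ _ _ _ _ _ _)).trans
      (K8_isIsomorphic _ _ _).symm⟩)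
  · exact .inr (.inr ⟨a / α, δ / α, hp, abs_pos.2 (div_ne_zero hδ hα), hs,
      h'.trans (K11_isIsomorphic _ _ _ _).symm⟩)

theorem isIsomorphic_of_one_block {a α δ : ℝ} (ha : a ≠ 0)
    (h : IsIsomorphic L (AlmostAbelianAlgebra (normalForm a 0 0 0 0 (-a / 2) α 0 δ))) :
    (∃ p : ℝ, p ≠ 0 ∧ IsIsomorphic L (K8 p (-p / 2) 0)) ∨
      (∃ p s : ℝ, p ≠ 0 ∧ s ≠ 0 ∧ IsIsomorphic L (K11 p (-p / 2) 0 s)) ∨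
      IsIsomorphic L (K17 (-1 / 2)) ∨
      (∃ p : ℝ, p ≠ 0 ∧ IsIsomorphic L (K19 p (-p / 2))) := by
  by_cases hα : α = 0
  · subst hα
    by_cases hδ : δ = 0
    · subst hδ
      have h' := h.scale_real ha
      rw [show -a / 2 / a = -1 / 2 by field_simp, zero_div] at h'
      exact .inr (.inr (.inl (h'.trans (K17_isIsomorphic _).symm)))
    · have h' := h.scale_second hδ
      rw [show -a / 2 / δ = -(a / δ) / 2 by ring, zero_div] at h'
      exact .inl ⟨a / δ, div_ne_zero ha hδ, h'.trans (K8_isIsomorphic _ _ _).symm⟩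
  · have h' := h.scale_first hα
    rw [show -a / 2 / α = -(a / α) / 2 by ring, zero_div] at h'
    by_cases hδ : δ = 0
    · rw [hδ, zero_div] at h'
      exact .inr (.inr (.inr ⟨a / α, div_ne_zero ha hα, h'.trans (K19_isIsomorphic _ _).symm⟩))
    · exact .inr (.inl ⟨a / α, δ / α, div_ne_zero ha hα, div_ne_zero hδ hα,
        h'.trans (K11_isIsomorphic _ _ _ _).symm⟩)

theorem admitsSKT_and_not_admitsKahler_iff (hL : Module.finrank ℝ L = 6) (hA : IsAlmostAbelian L)
    (hN : ¬ LieRing.IsNilpotent L) :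
    AdmitsSKT L ∧ ¬ AdmitsKahler L ↔
      IsIsomorphic L (K1 (-1 / 2) (-1 / 2)) ∨
      (∃ p : ℝ, p ≠ 0 ∧ IsIsomorphic L (K8 p (-p / 2) 0)) ∨
      (∃ p : ℝ, p ≠ 0 ∧ IsIsomorphic L (K8 p (-p / 2) (-p / 2))) ∨
      (∃ p s : ℝ, p ≠ 0 ∧ s ≠ 0 ∧ IsIsomorphic L (K11 p (-p / 2) 0 s)) ∨
      (∃ p s : ℝ, p ≠ 0 ∧ 0 < |s| ∧ |s| ≤ 1 ∧ IsIsomorphic L (K11 p (-p / 2) (-p / 2) s)) ∨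
      IsIsomorphic L (K17 (-1 / 2)) ∨
      (∃ p : ℝ, p ≠ 0 ∧ IsIsomorphic L (K19 p (-p / 2))) ∨
      IsIsomorphic L (K23 0) := by
  have half {p : ℝ} (hp : p ≠ 0) : -p / 2 ≠ 0 := div_ne_zero (neg_ne_zero.2 hp) two_ne_zero
  have key {a v₁ v₂ v₃ v₄ c α d δ : ℝ} (hc : c ≠ 0) (hc' : c = -a / 2) (hd : d = 0 ∨ d = -a / 2)
      (h : IsIsomorphic L (AlmostAbelianAlgebra (normalForm a v₁ v₂ v₃ v₄ c α d δ))) :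
      AdmitsSKT L ∧ ¬ AdmitsKahler L :=
    ⟨admitsSKT_of_normalForm h (.inr hc') hd, not_admitsKahler_of_ne_zero hL hA hc h⟩
  constructor
  · rintro ⟨hS, hK⟩
    obtain ⟨a, v₁, v₂, v₃, v₄, c, α, d, δ, hc, hd, h⟩ := hS.exists_normalForm hL hA
    by_cases ha : a = 0
    · subst ha
      simp only [neg_zero, zero_div, or_self] at hc hd
      subst hc hd
      simp only [isIsomorphic_K23_of_normalForm h hN hK, or_true]
    -- The eigenvalues of the blocks have real part `0` or `-a / 2`, hence differ from `a`.
    have hne {b β : ℝ} (hb : b = 0 ∨ b = -a / 2) : (b - a) ^ 2 + β ^ 2 ≠ 0 := by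
      have : b - a ≠ 0 := by
        rcases hb with rfl | rfl <;> intro h0 <;> apply ha <;> linarith
      positivity
    replace h := h.trans (normalForm_remove_both _ _ _ _ _ _ _ _ _ (hne hc) (hne hd))
    rcases hc with rfl | rfl <;> rcases hd with rfl | rfl
    · exact absurd (admitsKahler_of_normalForm h) hK
    · have := isIsomorphic_of_one_block ha (h.trans (normalForm_swap _ _ _ _ _ _ _ _ _))
      rcases this with h | h | h | h <;> simp only [h, true_or, or_true]
    · rcases isIsomorphic_of_one_block ha h with h | h | h | h <;> simp only [h, true_or, or_true]
    · rcases isIsomorphic_of_both_blocks ha h with h | h | h <;> simp only [h, true_or, or_true]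
  · rintro (h | ⟨p, hp, h⟩ | ⟨p, hp, h⟩ | ⟨p, s, hp, -, h⟩ | ⟨p, s, hp, -, -, h⟩ | h |
      ⟨p, hp, h⟩ | h)
    · exact key (by norm_num) rfl (.inr rfl) (h.trans (K1_isIsomorphic _ _))
    · exact key (half hp) rfl (.inl rfl) (h.trans (K8_isIsomorphic _ _ _))
    · exact key (half hp) rfl (.inr rfl) (h.trans (K8_isIsomorphic _ _ _))
    · exact key (half hp) rfl (.inl rfl) (h.trans (K11_isIsomorphic _ _ _ _))
    · exact key (half hp) rfl (.inr rfl) (h.trans (K11_isIsomorphic _ _ _ _))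
    · exact key (by norm_num) rfl (.inl rfl) (h.trans (K17_isIsomorphic _))
    · exact key (half hp) rfl (.inl rfl) (h.trans (K19_isIsomorphic _ _))
    · have h' := h.trans K23_isIsomorphic
      exact ⟨admitsSKT_of_normalForm h' (.inl rfl) (.inl rfl), not_admitsKahler_of_jordan hL hA h'⟩

end Classification

theorem finrank_lieAlg (G : Type*) [TopologicalSpace G]
    [ChartedSpace (EuclideanSpace ℝ (Fin 6)) G] [Group G] [LieGroup (𝓡 6) ∞ G] :
    Module.finrank ℝ (LieAlg G) = 6 :=
  finrank_euclideanSpace_fin (𝕜 := ℝ) (n := 6)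

end AlmostAbelianSKT
open AlmostAbelianSKT in
theorem theorem3p5 :
    (∀ (G : Type*) [TopologicalSpace G] [ChartedSpace (EuclideanSpace ℝ (Fin 6)) G] [Group G]
        [LieGroup (𝓡 6) ∞ G] [ConnectedSpace G] [SimplyConnectedSpace G],
      IsAlmostAbelianGroup G → ¬ IsNilpotentGroup G →
        (AdmitsLeftInvariantKahler G ↔
          (∃ p s : ℝ, p ≠ 0 ∧ 0 < |s| ∧ |s| ≤ 1 ∧ IsIsomorphic (LieAlg G) (K11 p 0 0 s)) ∨
          IsIsomorphic (LieAlg G) K13 ∨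
          IsIsomorphic (LieAlg G) (K15 0) ∨
          (∃ p : ℝ, p ≠ 0 ∧ IsIsomorphic (LieAlg G) (K19 p 0)) ∨
          (∃ r : ℝ, 0 < |r| ∧ |r| ≤ 1 ∧ IsIsomorphic (LieAlg G) (K25 0 0 r))) ∧
        (AdmitsLeftInvariantSKT G ∧ ¬ AdmitsLeftInvariantKahler G ↔
          IsIsomorphic (LieAlg G) (K1 (-1 / 2) (-1 / 2)) ∨
          (∃ p : ℝ, p ≠ 0 ∧ IsIsomorphic (LieAlg G) (K8 p (-p / 2) 0)) ∨
          (∃ p : ℝ, p ≠ 0 ∧ IsIsomorphic (LieAlg G) (K8 p (-p / 2) (-p / 2))) ∨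
          (∃ p s : ℝ, p ≠ 0 ∧ s ≠ 0 ∧ IsIsomorphic (LieAlg G) (K11 p (-p / 2) 0 s)) ∨
          (∃ p s : ℝ, p ≠ 0 ∧ 0 < |s| ∧ |s| ≤ 1 ∧
            IsIsomorphic (LieAlg G) (K11 p (-p / 2) (-p / 2) s)) ∨
          IsIsomorphic (LieAlg G) (K17 (-1 / 2)) ∨
          (∃ p : ℝ, p ≠ 0 ∧ IsIsomorphic (LieAlg G) (K19 p (-p / 2))) ∨
          IsIsomorphic (LieAlg G) (K23 0))) ∧
    ((∀ p s : ℝ, p ≠ 0 → 0 < |s| → |s| ≤ 1 → ¬ IsUnimodular (K11 p 0 0 s)) ∧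
      ¬ IsUnimodular K13 ∧
      IsUnimodular (K15 0) ∧
      (∀ p : ℝ, p ≠ 0 → ¬ IsUnimodular (K19 p 0)) ∧
      (∀ r : ℝ, 0 < |r| → |r| ≤ 1 → IsUnimodular (K25 0 0 r))) ∧
    (¬ IsUnimodular (K1 (-1 / 2) (-1 / 2)) ∧
      (∀ p : ℝ, p ≠ 0 → IsUnimodular (K8 p (-p / 2) 0)) ∧
      (∀ p : ℝ, p ≠ 0 → ¬ IsUnimodular (K8 p (-p / 2) (-p / 2))) ∧
      (∀ p s : ℝ, p ≠ 0 → s ≠ 0 → IsUnimodular (K11 p (-p / 2) 0 s)) ∧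
      (∀ p s : ℝ, p ≠ 0 → 0 < |s| → |s| ≤ 1 → ¬ IsUnimodular (K11 p (-p / 2) (-p / 2) s)) ∧
      IsUnimodular (K17 (-1 / 2)) ∧
      (∀ p : ℝ, p ≠ 0 → IsUnimodular (K19 p (-p / 2))) ∧
      IsUnimodular (K23 0)) := by
  refine ⟨fun G _ _ _ _ _ _ hA hN => ⟨admitsKahler_iff (finrank_lieAlg G) hA hN,
    admitsSKT_and_not_admitsKahler_iff (finrank_lieAlg G) hA hN⟩, ⟨?_, ?_, ?_, ?_, ?_⟩,
    ⟨?_, ?_, ?_, ?_, ?_, ?_, ?_, ?_⟩⟩ <;> intros <;>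
    simp only [AlmostAbelianAlgebra.isUnimodular_iff, Matrix.trace, Matrix.diag_apply,
      Fin.sum_univ_five] <;> simp <;>
    first
    | assumption
    | linarith
    | exact fun h => ‹_ ≠ (0 : ℝ)› (by linarith)
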